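/- Let $K$ be a complete field with a non-trivial discrete valuation $\nu : K \to \mathbb{Z}\cup\{\infty\}$, normalized so that the uniformizing parameter $p \in K$ has $\nu(p)=1$; let $\mathcal{O}_K$ be its valuation ring and $\mathfrak{K}$ its residue field. Let $R \subseteq \mathcal{O}_K$ be a dense noetherian subring, let $x=(x_1,\dots,x_n)$, and let $\pi : R[\![t]\!][x] \to K[x]$ be the ring homomorphism given on coefficients by $\sum_\beta c_\beta t^\beta \mapsto \sum_\beta c_\beta p^\beta$. Conventions. Let $>$ be the $t$-local lexicographical ordering on the monomials $t^\beta x^\alpha$ with $x_1 > \dots > x_n > 1 > t$. For $u \in \mathbb{R}_{<0}\times\mathbb{R}^n$ let $>_u$ be the weighted ordering that compares first $u\cdot(\beta,\alpha)$ and breaks ties by $>$; write $\mathrm{lt}_{>_u}(g)$ for the leading term of $g \in R[\![t]\!][x]$ (with $\mathrm{lt}_{>_u}(0)=0$), and $\mathrm{in}_u(g) \in R[t,x]$ for the sum of the terms $c\,t^\beta x^\alpha$ of $g$ with $u\cdot(\beta,\alpha)$ maximal. A finite subset $G$ of an ideal $J$ is a standard basis of $J$ with respect to an ordering if the leading terms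 of the elements of $G$ generate the ideal generated by the leading terms of all elements of $J$. A finite set $G\subseteq R[\![t]\!][x]$ is initially reduced with respect to $>_u$ if the set $G' = \{\sum_\alpha \mathrm{lt}_>(g_\alpha)\, x^\alpha \mid g=\sum_\alpha g_\alpha x^\alpha \in G\}$ (with $g_\alpha \in R[\![t]\!]$) is reduced, i.e. for each $g'\in G'$, $\mathrm{lt}_{>_u}(g')$ does not lie in the ideal generated by the leading terms of the other elements of $G'$, and no non-leading term of $g'$ lies in the ideal generated by the leading terms of $G'$. For $f=\sum_\alpha c_\alpha x^\alpha \in K[x]$ and $w\in\mathbb{R}^n$ put $\mathrm{in}_{\nu,w}(f)=\sum \overline{c_\alpha p^{-\nu(c_\alpha)}}\,x^\alpha\in\mathfrak{K}[x]$, the sum running over the $\alpha$ with $c_\alpha\neq 0$ for which $w\cdot\alpha-\nu(c_\alpha)$ is maximal, and for an ideal $I$ let $\mathrm{in}_{\nu,w}(I)=\langle \mathrm{in}_{\nu,w}(f)\mid f\in I\rangle$. Statement. Let $I \unlhd K[x]$ be a homogeneous ideal, let $w\in\mathbb{R}^n$, and let $G$ be an initially reduced standard basis of $\pi^{-1}I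 \unlhd R[\![t]\!][x]$ with respect to $>_{(-1,w)}$. Then $$\left\{\overline{\mathrm{in}_{(-1,w)}(g)}\big|_{t=1} \;\middle|\; g\in G\right\}\subseteq \mathfrak{K}[x]$$ is a standard basis of $\mathrm{in}_{\nu,w}(I)$ with respect to the lexicographical ordering with $x_1>\dots>x_n$. Moreover $\pi(G)$ is a Gröbner basis of $I$ over the valued field $K$ with respect to $w$, i.e. a finite generating set of $I$ whose initial forms $\mathrm{in}_{\nu,w}(\pi(g))$, $g\in G$, generate $\mathrm{in}_{\nu,w}(I)$. -/

import Mathlib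

open scoped WithZero Valued

noncomputable section

namespace ValuedStandardBases

/-! ### Initial forms and standard bases in `A⟦t⟧[x₁,…,xₙ]`

Elements of `A⟦t⟧[x]` are multivariate polynomials over `PowerSeries A`; the monomial
`t ^ β * x ^ α` is the pair `(β, α)`, and `w = (w₀, w₁, …, wₙ)` is the pair `(w₀, (w₁, …, wₙ))`. -/

/-- Monomials `t ^ β * x ^ α` in the variables `t, x₁, …, xₙ`. -/
abbrev Mon (n : ℕ) : Type := ℕ × (Fin n →₀ ℕ)

/-- The weighted degree `w · (β, α)`. -/
def weight {n : ℕ} (w : ℝ × (Fin n → ℝ)) (m : Mon n) : ℝ :=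
  w.1 * m.1 + ∑ i, w.2 i * m.2 i

/-- `m < m'` in the `t`-local lexicographical ordering with `x₁ > … > xₙ > 1 > t`. -/
def LexLT {n : ℕ} (m m' : Mon n) : Prop :=
  toLex m.2 < toLex m'.2 ∨ (m.2 = m'.2 ∧ m'.1 < m.1)

/-- `m <_w m'` in the weighted ordering with weight vector `w` and tiebreaker `LexLT`. -/
def WeightedLT {n : ℕ} (w : ℝ × (Fin n → ℝ)) (m m' : Mon n) : Prop :=
  weight w m < weight w m' ∨ (weight w m = weight w m' ∧ LexLT m m')

section PowerSeriesPolynomials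

variable {n : ℕ} {A : Type*} [CommRing A]

/-- The coefficient in `A` of `t ^ β * x ^ α` in `f`. -/
def coeffAt (f : MvPolynomial (Fin n) (PowerSeries A)) (m : Mon n) : A :=
  PowerSeries.coeff m.1 (MvPolynomial.coeff m.2 f)

/-- The term of `f` at the monomial `m`, as an element of `A⟦t⟧[x]`. -/
def termAt (f : MvPolynomial (Fin n) (PowerSeries A)) (m : Mon n) :
    MvPolynomial (Fin n) (PowerSeries A) :=
  MvPolynomial.monomial m.2 (PowerSeries.monomial m.1 (coeffAt f m))

/-- `m` is the maximal monomial of `f` with respect to `>_w`. -/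
def IsLeadingMonomial (w : ℝ × (Fin n → ℝ)) (f : MvPolynomial (Fin n) (PowerSeries A))
    (m : Mon n) : Prop :=
  coeffAt f m ≠ 0 ∧ ∀ m', coeffAt f m' ≠ 0 → m' ≠ m → WeightedLT w m' m

open Classical in
/-- The leading term of `f` with respect to `>_w`; for `w₀ < 0` every nonzero `f` has exactly one
leading monomial (`existsUnique_isLeadingMonomial`). -/
def leadingTerm (w : ℝ × (Fin n → ℝ)) (f : MvPolynomial (Fin n) (PowerSeries A)) :
    MvPolynomial (Fin n) (PowerSeries A) :=
  if h : ∃ m, IsLeadingMonomial w f m then termAt f h.choose else 0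

/-- The ideal generated by the leading terms of all elements of `S`. -/
def leadingIdeal (w : ℝ × (Fin n → ℝ)) (S : Set (MvPolynomial (Fin n) (PowerSeries A))) :
    Ideal (MvPolynomial (Fin n) (PowerSeries A)) :=
  Ideal.span (leadingTerm w '' S)

/-- `G` is a standard basis of the ideal `J` of `A⟦t⟧[x]` with respect to `>_w`. -/
def IsStandardBasis (w : ℝ × (Fin n → ℝ)) (J : Ideal (MvPolynomial (Fin n) (PowerSeries A)))
    (G : Set (MvPolynomial (Fin n) (PowerSeries A))) : Prop :=
  G.Finite ∧ G ⊆ (J : Set (MvPolynomial (Fin n) (PowerSeries A))) ∧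
    leadingIdeal w G = leadingIdeal w (J : Set (MvPolynomial (Fin n) (PowerSeries A)))

/-- A set is reduced if it is minimal (no leading term lies in the ideal generated by the leading
terms of the other elements) and no term of the tail of an element lies in the leading ideal. -/
def IsReducedSet (w : ℝ × (Fin n → ℝ)) (H : Set (MvPolynomial (Fin n) (PowerSeries A))) : Prop :=
  ∀ g ∈ H, leadingTerm w g ∉ leadingIdeal w (H \ {g}) ∧
    ∀ m, coeffAt g m ≠ 0 → ¬ IsLeadingMonomial w g m → termAt g m ∉ leadingIdeal w H

/-- The lowest-order term of a power series in `t`, i.e. its leading term for the `t`-local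
ordering `1 > t`. -/
def lowestTerm (φ : PowerSeries A) : PowerSeries A :=
  PowerSeries.monomial φ.order.toNat (PowerSeries.coeff φ.order.toNat φ)

/-- Replace every coefficient in `A⟦t⟧` of `f = ∑ f_α x ^ α` by its leading term. -/
def truncation (f : MvPolynomial (Fin n) (PowerSeries A)) : MvPolynomial (Fin n) (PowerSeries A) :=
  ∑ α ∈ f.support, MvPolynomial.monomial α (lowestTerm (MvPolynomial.coeff α f))

/-- `G` is initially reduced with respect to `>_w`. -/
def IsInitiallyReduced (w : ℝ × (Fin n → ℝ))
    (G : Set (MvPolynomial (Fin n) (PowerSeries A))) : Prop :=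
  IsReducedSet w (truncation '' G)

/-- The monomials of `f` of maximal weighted degree. -/
def initialSupport (w : ℝ × (Fin n → ℝ)) (f : MvPolynomial (Fin n) (PowerSeries A)) :
    Set (Mon n) :=
  {m | coeffAt f m ≠ 0 ∧ ∀ m', coeffAt f m' ≠ 0 → weight w m' ≤ weight w m}

/-- The initial form `in_w(f) ∈ A[t][x]`: the sum of the terms of `f` of maximal weighted degree.
For `w₀ < 0` there are only finitely many of them (`finite_initialSupport`). -/
def initialForm (w : ℝ × (Fin n → ℝ)) (f : MvPolynomial (Fin n) (PowerSeries A)) :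
    MvPolynomial (Fin n) (Polynomial A) :=
  ∑ᶠ m ∈ initialSupport w f,
    MvPolynomial.monomial m.2 (Polynomial.monomial m.1 (coeffAt f m))

theorem order_le_of_coeffAt_ne_zero {f : MvPolynomial (Fin n) (PowerSeries A)} {m : Mon n}
    (h : coeffAt f m ≠ 0) :
    m.2 ∈ f.support ∧ (MvPolynomial.coeff m.2 f).order.toNat ≤ m.1 ∧
      coeffAt f ((MvPolynomial.coeff m.2 f).order.toNat, m.2) ≠ 0 := by
  have h0 : MvPolynomial.coeff m.2 f ≠ 0 := by
    intro h0
    exact h (by simp [coeffAt, h0])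
  refine ⟨MvPolynomial.mem_support_iff.2 h0, ?_, ?_⟩
  · exact ENat.toNat_le_of_le_natCast (PowerSeries.order_le _ h)
  · exact PowerSeries.coeff_order h0

theorem finite_initialSupport {w : ℝ × (Fin n → ℝ)} (hw : w.1 < 0)
    (f : MvPolynomial (Fin n) (PowerSeries A)) : (initialSupport w f).Finite := by
  refine (f.support.finite_toSet.image
    (fun α => ((MvPolynomial.coeff α f).order.toNat, α))).subset ?_
  rintro m ⟨hm, hmax⟩
  obtain ⟨h1, h2, h3⟩ := order_le_of_coeffAt_ne_zero hm
  refine ⟨m.2, h1, ?_⟩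
  refine Prod.ext ?_ rfl
  have h4 := hmax _ h3
  simp only [weight, add_le_add_iff_right] at h4
  have h5 : (m.1 : ℝ) ≤ ((MvPolynomial.coeff m.2 f).order.toNat : ℝ) := by nlinarith
  exact le_antisymm h2 (by exact_mod_cast h5)

theorem LexLT.trans {a b c : Mon n} (h : LexLT a b) (h' : LexLT b c) : LexLT a c := by
  rcases h with h | ⟨h, h2⟩ <;> rcases h' with h' | ⟨h', h2'⟩
  · exact Or.inl (h.trans h')
  · exact Or.inl (h' ▸ h)
  · exact Or.inl (h ▸ h')
  · exact Or.inr ⟨h.trans h', h2'.trans h2⟩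

theorem WeightedLT.trans {w : ℝ × (Fin n → ℝ)} {a b c : Mon n} (h : WeightedLT w a b)
    (h' : WeightedLT w b c) : WeightedLT w a c := by
  rcases h with h | ⟨h, h2⟩ <;> rcases h' with h' | ⟨h', h2'⟩
  · exact Or.inl (h.trans h')
  · exact Or.inl (h' ▸ h)
  · exact Or.inl (h ▸ h')
  · exact Or.inr ⟨h.trans h', h2.trans h2'⟩

theorem WeightedLT.irrefl {w : ℝ × (Fin n → ℝ)} (a : Mon n) : ¬ WeightedLT w a a := by
  rintro (h | ⟨-, h | ⟨-, h⟩⟩) <;> exact lt_irrefl _ h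

theorem WeightedLT.trichotomous {w : ℝ × (Fin n → ℝ)} (a b : Mon n) :
    WeightedLT w a b ∨ a = b ∨ WeightedLT w b a := by
  rcases lt_trichotomy (weight w a) (weight w b) with h | h | h
  · exact Or.inl (Or.inl h)
  · rcases lt_trichotomy (toLex a.2) (toLex b.2) with h2 | h2 | h2
    · exact Or.inl (Or.inr ⟨h, Or.inl h2⟩)
    · have h2 : a.2 = b.2 := toLex.injective h2
      rcases lt_trichotomy a.1 b.1 with h3 | h3 | h3
      · exact Or.inr (Or.inr (Or.inr ⟨h.symm, Or.inr ⟨h2.symm, h3⟩⟩))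
      · exact Or.inr (Or.inl (Prod.ext h3 h2))
      · exact Or.inl (Or.inr ⟨h, Or.inr ⟨h2, h3⟩⟩)
    · exact Or.inr (Or.inr (Or.inr ⟨h.symm, Or.inl h2⟩))
  · exact Or.inr (Or.inr (Or.inl h))

theorem existsUnique_isLeadingMonomial {w : ℝ × (Fin n → ℝ)} (hw : w.1 < 0)
    {f : MvPolynomial (Fin n) (PowerSeries A)} (hf : f ≠ 0) :
    ∃! m, IsLeadingMonomial w f m := by
  have key : ∀ s : Finset (Fin n →₀ ℕ), s.Nonempty →
      ∃ α ∈ s, ∀ γ ∈ s, γ ≠ α →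
        WeightedLT w ((MvPolynomial.coeff γ f).order.toNat, γ)
          ((MvPolynomial.coeff α f).order.toNat, α) := by
    intro s hs
    induction hs using Finset.Nonempty.cons_induction with
    | singleton a => exact ⟨a, by simp, by simp⟩
    | cons a s ha hs ih =>
      obtain ⟨α, hα, hmax⟩ := ih
      rcases WeightedLT.trichotomous (w := w) ((MvPolynomial.coeff a f).order.toNat, a)
        ((MvPolynomial.coeff α f).order.toNat, α) with h | h | h
      · refine ⟨α, by simp [hα], fun γ hγ hne => ?_⟩
        rcases Finset.mem_cons.1 hγ with rfl | hγ
        · exact h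
        · exact hmax γ hγ hne
      · have h' : a = α := congrArg Prod.snd h
        exact absurd (h'.symm ▸ hα) ha
      · refine ⟨a, by simp, fun γ hγ hne => ?_⟩
        rcases Finset.mem_cons.1 hγ with rfl | hγ
        · exact absurd rfl hne
        · by_cases hγα : γ = α
          · exact hγα ▸ h
          · exact (hmax γ hγ hγα).trans h
  obtain ⟨α, hα, hmax⟩ := key f.support
    (Finset.nonempty_iff_ne_empty.2 (fun h => hf (MvPolynomial.support_eq_empty.1 h)))
  have hlead : IsLeadingMonomial w f ((MvPolynomial.coeff α f).order.toNat, α) := by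
    refine ⟨PowerSeries.coeff_order (MvPolynomial.mem_support_iff.1 hα), ?_⟩
    intro m hm hne
    obtain ⟨h1, h2, -⟩ := order_le_of_coeffAt_ne_zero hm
    have hlast : m = ((MvPolynomial.coeff m.2 f).order.toNat, m.2) ∨
        WeightedLT w m ((MvPolynomial.coeff m.2 f).order.toNat, m.2) := by
      rcases h2.eq_or_lt with h2 | h2
      · exact Or.inl (Prod.ext h2.symm rfl)
      · refine Or.inr (Or.inl ?_)
        simp only [weight, add_lt_add_iff_right]
        exact mul_lt_mul_of_neg_left (by exact_mod_cast h2) hw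
    by_cases h : m.2 = α
    · subst h
      exact hlast.resolve_left hne
    · rcases hlast with h' | h'
      · rw [h']
        exact hmax _ h1 h
      · exact h'.trans (hmax _ h1 h)
  refine ⟨_, hlead, fun m hm => ?_⟩
  by_contra hne
  exact WeightedLT.irrefl _ ((hm.2 _ hlead.1 (Ne.symm hne)).trans (hlead.2 _ hm.1 hne))

end PowerSeriesPolynomials

/-! ### Lexicographical standard bases over a field -/

/-- `G` is a standard basis of the ideal `J` of `k[x]` with respect to the lexicographical ordering
with `x₁ > … > xₙ`. -/
def IsLexStandardBasis {n : ℕ} {k : Type*} [Field k] (J : Ideal (MvPolynomial (Fin n) k))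
    (G : Set (MvPolynomial (Fin n) k)) : Prop :=
  G.Finite ∧ G ⊆ (J : Set (MvPolynomial (Fin n) k)) ∧
    Ideal.span ((MonomialOrder.lex (σ := Fin n)).leadingTerm '' G) =
      Ideal.span ((MonomialOrder.lex (σ := Fin n)).leadingTerm ''
        (J : Set (MvPolynomial (Fin n) k)))

section Homogeneous

attribute [local instance] MvPolynomial.gradedAlgebra

/-- Homogeneous ideals of `k[x]` for the standard grading. -/
def IsHomogeneousIdeal {n : ℕ} {k : Type*} [Field k] (I : Ideal (MvPolynomial (Fin n) k)) : Prop :=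
  I.IsHomogeneous (MvPolynomial.homogeneousSubmodule (Fin n) k)

end Homogeneous

/-! ### Initial forms over a discretely valued field -/

section ValuedField

variable {K : Type*} [Field K] [Valued K ℤᵐ⁰]

/-- The additive valuation `ν(c)` of a nonzero `c ∈ K`. -/
def val (c : K) : ℤ := -WithZero.log (Valued.v c)

open Classical in
/-- The residue class in the residue field of an element of the valuation ring. -/
def residueClass (c : K) : 𝓀[K] :=
  if h : c ∈ 𝒪[K] then IsLocalRing.residue 𝒪[K] ⟨c, h⟩ else 0

/-- `residueClass` is only ever applied to elements of the valuation ring. -/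
theorem mul_zpow_mem_integer {p : K} (hp : Valued.v p = WithZero.exp (-1 : ℤ)) {c : K}
    (hc : c ≠ 0) : c * p ^ (-val c) ∈ 𝒪[K] := by
  have hv : Valued.v c ≠ 0 := by simpa using hc
  change Valued.v (c * p ^ (-val c)) ≤ 1
  rw [map_mul, map_zpow₀, hp, ← WithZero.exp_log hv, ← WithZero.exp_zsmul, ← WithZero.exp_add,
    ← WithZero.exp_zero, WithZero.exp_le_exp, val]
  simp

/-- The valued weight `w · α - ν(c_α)` of the term of `f` at `x ^ α`. -/
def valuedWeight {n : ℕ} (w : Fin n → ℝ) (f : MvPolynomial (Fin n) K) (α : Fin n →₀ ℕ) : ℝ :=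
  ∑ i, w i * α i - val (MvPolynomial.coeff α f)

open Classical in
/-- The initial form `in_{ν,w}(f)`: the sum of the terms
`residue (c_α * p ^ (-ν(c_α))) * x ^ α` over the `α` in the support of `f` with maximal
`w · α - ν(c_α)`. -/
def valuedInitialForm {n : ℕ} (p : K) (w : Fin n → ℝ) (f : MvPolynomial (Fin n) K) :
    MvPolynomial (Fin n) 𝓀[K] :=
  ∑ α ∈ f.support with ∀ γ ∈ f.support, valuedWeight w f γ ≤ valuedWeight w f α,
    MvPolynomial.monomial α
      (residueClass (MvPolynomial.coeff α f * p ^ (-val (MvPolynomial.coeff α f))))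

/-- The ideal `in_{ν,w}(S)` generated by the initial forms of all elements of `S`. -/
def valuedInitialIdeal {n : ℕ} (p : K) (w : Fin n → ℝ) (S : Set (MvPolynomial (Fin n) K)) :
    Ideal (MvPolynomial (Fin n) 𝓀[K]) :=
  Ideal.span (valuedInitialForm p w '' S)

/-- `B` is a Gröbner basis of `I` over the valued field `K` with respect to `w`: a finite
generating set whose initial forms generate `in_{ν,w}(I)`. -/
def IsValuedGroebnerBasis {n : ℕ} (p : K) (w : Fin n → ℝ) (I : Ideal (MvPolynomial (Fin n) K))
    (B : Set (MvPolynomial (Fin n) K)) : Prop :=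
  B.Finite ∧ Ideal.span B = I ∧
    valuedInitialIdeal p w B = valuedInitialIdeal p w (I : Set (MvPolynomial (Fin n) K))

/-! ### The map `π : R⟦t⟧ → K`, `t ↦ p` -/

section Evaluation

theorem nonarchimedeanRing (K : Type*) [Field K] [Valued K ℤᵐ⁰] : NonarchimedeanRing K where
  is_nonarchimedean U hU := by
    obtain ⟨γ, hγ⟩ := Valued.mem_nhds_zero.1 hU
    exact ⟨⟨Valuation.ltAddSubgroup (Valuation.restrict (Valued.v (R := K))) γ, Valued.isOpen_ball K γ.1⟩, hγ⟩

theorem summable_mul_pow [CompleteSpace K] {p : K} (hp : Valued.v p = WithZero.exp (-1 : ℤ))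
    (a : ℕ → 𝒪[K]) : Summable fun β => (a β : K) * p ^ β := by
  have := nonarchimedeanRing K
  apply NonarchimedeanAddGroup.summable_of_tendsto_cofinite_zero
  rw [Nat.cofinite_eq_atTop]
  intro s hs
  obtain ⟨γ, hγ⟩ := Valued.mem_nhds_zero.1 hs
  have hγ0 : MonoidWithZeroHom.ValueGroup₀.embedding γ.1 ≠ (0 : ℤᵐ⁰) := by simp
  obtain ⟨k, hk⟩ := WithZero.exists_exp_neg_natCast_lt hγ0
  refine Filter.mem_atTop_sets.2 ⟨k, fun β hβ => hγ ?_⟩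
  change (Valued.v (R := K)).restrict (a β * p ^ β) < γ.1
  rw [Valuation.restrict_lt_iff_lt_embedding]
  refine lt_of_le_of_lt ?_ hk
  have ha : Valued.v (a β : K) ≤ 1 := (a β).2
  rw [map_mul, map_pow, hp, ← WithZero.exp_nsmul]
  refine (mul_le_mul_left ha _).trans ?_
  rw [one_mul, WithZero.exp_le_exp]
  simpa using hβ

theorem tsum_mul_pow_mul_tsum_aux {L : Type*} [CommRing L] [UniformSpace L] [IsUniformAddGroup L]
    [NonarchimedeanRing L] [T2Space L] {a b : ℕ → L} {p : L} (ha : Summable fun β => a β * p ^ β)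
    (hb : Summable fun β => b β * p ^ β) :
    (∑' β, a β * p ^ β) * (∑' β, b β * p ^ β) =
      ∑' β, (∑ ij ∈ Finset.HasAntidiagonal.antidiagonal β, a ij.1 * b ij.2) * p ^ β := by
  have hab := ha.mul_of_nonarchimedean hb
  rw [ha.tsum_mul_tsum_eq_tsum_sum_antidiagonal hb hab]
  refine tsum_congr fun β => ?_
  rw [Finset.sum_mul]
  refine Finset.sum_congr rfl fun ij hij => ?_
  rw [← Finset.HasAntidiagonal.mem_antidiagonal.1 hij, pow_add]
  ring

theorem tsum_mul_pow_mul_tsum [CompleteSpace K] {p : K}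
    (hp : Valued.v p = WithZero.exp (-1 : ℤ)) (a b : ℕ → 𝒪[K]) :
    (∑' β, (a β : K) * p ^ β) * (∑' β, (b β : K) * p ^ β) =
      ∑' β, (∑ ij ∈ Finset.HasAntidiagonal.antidiagonal β, (a ij.1 : K) * b ij.2) * p ^ β := by
  have := nonarchimedeanRing K
  exact tsum_mul_pow_mul_tsum_aux (summable_mul_pow hp a) (summable_mul_pow hp b)

/-- The ring homomorphism `R⟦t⟧ → K`, `∑ c_β t ^ β ↦ ∑ c_β p ^ β`, where the second sum is the limit
in the complete field `K` and `p` is a uniformizing parameter. -/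
def evalUniformizer [CompleteSpace K] (R : Subring 𝒪[K]) (p : K)
    (hp : Valued.v p = WithZero.exp (-1 : ℤ)) : PowerSeries R →+* K where
  toFun φ := ∑' β : ℕ, (((PowerSeries.coeff β φ : R) : 𝒪[K]) : K) * p ^ β
  map_zero' := by simp
  map_one' := by
    rw [tsum_eq_single 0]
    · simp
    · intro β hβ
      simp [PowerSeries.coeff_one, hβ]
  map_add' φ ψ := by
    have hφ := summable_mul_pow hp (fun β => ((PowerSeries.coeff β φ : R) : 𝒪[K]))
    have hψ := summable_mul_pow hp (fun β => ((PowerSeries.coeff β ψ : R) : 𝒪[K]))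
    rw [← hφ.tsum_add hψ]
    refine tsum_congr fun β => ?_
    rw [map_add]
    push_cast
    ring
  map_mul' φ ψ := by
    rw [tsum_mul_pow_mul_tsum hp]
    refine tsum_congr fun β => ?_
    rw [PowerSeries.coeff_mul]
    push_cast
    rfl

/-- The map `π : R⟦t⟧[x] → K[x]`, acting by `t ↦ p` on coefficients. -/
def projection [CompleteSpace K] {n : ℕ} (R : Subring 𝒪[K]) (p : K)
    (hp : Valued.v p = WithZero.exp (-1 : ℤ)) :
    MvPolynomial (Fin n) (PowerSeries R) →+* MvPolynomial (Fin n) K :=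
  MvPolynomial.map (evalUniformizer R p hp)

end Evaluation

/-- The map `R[t][x] → 𝔎[x]`: set `t = 1` and reduce the coefficients to the residue field. -/
def residueAtOne {n : ℕ} (R : Subring 𝒪[K]) :
    MvPolynomial (Fin n) (Polynomial R) →+* MvPolynomial (Fin n) 𝓀[K] :=
  MvPolynomial.map
    ((IsLocalRing.residue 𝒪[K]).comp (R.subtype.comp (Polynomial.evalRingHom 1)))

end ValuedField

end ValuedStandardBases

end

/-!
Let `J = π⁻¹ I` and let `𝔭 ⊆ R` be the elements of positive valuation. Two facts drive the proof.

*Lifting* (`exists_lift_isLeadingMonomial`). By density of `R`, every element of the valuation ring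
has a `p`-adic expansion with digits in `R`, so up to a scalar every `f ∈ I` lifts to some `F ∈ J`
all of whose coefficients start with a digit that is a unit of the valuation ring
(`HasUnitLowest F`). For such `F`, taking initial forms commutes with `π`, and the leading monomial
of `F` with respect to `>_(-1,w)` has the lexicographical leading exponent of `in_{ν,w}(f)` as its
`x`-part. Every leading exponent of the ideal `in_{ν,w}(I)` is that of a single initial form
`in_{ν,w}(f)`, `f ∈ I` (`exists_isValuedLeading_degree`), because `in_{ν,w}(I)` is graded by the
classes of weights modulo `ℤ`, and within a class a sum of initial forms is again an initial form
or zero.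

*Reducedness.* Every constant `r ∈ 𝔭` is the leading term of some `r - t * φ ∈ ker π ⊆ J`
(`C_mem_leadingIdeal`). Hence the tail of each `g ∈ G` has unit lowest coefficients, and if the
leading coefficient of `g` is not a unit, then minimality forces the leading monomial of `g` to be
`1`; in that case `in_(-1,w)(g)` is a constant in `𝔭` and vanishes in the residue field
(`IsInitiallyReduced.hasUnitLowest_or`). For the remaining `g` the residue of `in_(-1,w)(g)` at
`t = 1` is `in_{ν,w}(π g)`.

Given `f ∈ I` with lift `F`, the leading coefficient of `F` is a unit, so membership of its leading
term in the leading ideal of `G` yields a `g` of the second kind whose leading monomial divides that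
of `F` (`IsInitiallyReduced.exists_le_of_isValuedLeading`). This gives the lexicographical standard
basis, and division with remainder then gives generation of `in_{ν,w}(I)`.

That `π(G)` generates `I` itself needs homogeneity: reducedness makes every `g ∈ G` homogeneous
in `x` (`IsInitiallyReduced.isHomogeneous`), and within one degree the multiples of the `π g` with
the various leading exponents solve a square linear system that removes all leading exponents of `I`
from a given element of `I` (`span_eq_of_forall_exists_le`).
-/

noncomputable section

namespace ValuedStandardBases

/-! ### Evaluation at the uniformizer -/

section Evaluation

variable {K : Type*} [Field K] [Valued K ℤᵐ⁰] {p : K}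

theorem mem_integer_iff {c : K} : c ∈ 𝒪[K] ↔ Valued.v c ≤ 1 := Iff.rfl

theorem uniformizer_ne_zero (hp : Valued.v p = WithZero.exp (-1 : ℤ)) : p ≠ 0 := by
  rintro rfl
  rw [map_zero] at hp
  exact WithZero.exp_ne_zero hp.symm

theorem v_zpow (hp : Valued.v p = WithZero.exp (-1 : ℤ)) (k : ℤ) :
    Valued.v (p ^ k) = WithZero.exp (-k) := by
  rw [map_zpow₀, hp, ← WithZero.exp_zsmul]
  simp

theorem v_eq_exp_neg_val {c : K} (hc : c ≠ 0) : Valued.v c = WithZero.exp (-val c) := by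
  have hv : Valued.v c ≠ 0 := by simpa using hc
  rw [val, neg_neg, WithZero.exp_log hv]

theorem val_eq_of_v_eq {c : K} {k : ℤ} (h : Valued.v c = WithZero.exp (-k)) : val c = k := by
  simp [val, h]

theorem v_mul_zpow_neg_val (hp : Valued.v p = WithZero.exp (-1 : ℤ)) {c : K} (hc : c ≠ 0) :
    Valued.v (c * p ^ (-val c)) = 1 := by
  rw [map_mul, v_eq_exp_neg_val hc, v_zpow hp, ← WithZero.exp_add]
  simp

theorem val_mul {c d : K} (hc : c ≠ 0) (hd : d ≠ 0) : val (c * d) = val c + val d := by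
  apply val_eq_of_v_eq
  rw [map_mul, v_eq_exp_neg_val hc, v_eq_exp_neg_val hd, ← WithZero.exp_add]
  congr 1
  ring

theorem exists_eq_mul_of_v_lt_one (hp : Valued.v p = WithZero.exp (-1 : ℤ)) {c : K}
    (hc : Valued.v c < 1) : ∃ d : 𝒪[K], c = p * d := by
  have hp0 := uniformizer_ne_zero hp
  refine ⟨⟨c / p, ?_⟩, (mul_div_cancel₀ c hp0).symm⟩
  rw [mem_integer_iff, map_div₀, hp]
  rcases eq_or_ne c 0 with rfl | h0
  · simp
  · rw [v_eq_exp_neg_val h0] at hc ⊢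
    rw [← WithZero.exp_zero, WithZero.exp_lt_exp] at hc
    rw [← WithZero.exp_sub, ← WithZero.exp_zero, WithZero.exp_le_exp]
    lia

theorem residueClass_of_mem {c : K} (hc : c ∈ 𝒪[K]) :
    residueClass c = IsLocalRing.residue 𝒪[K] ⟨c, hc⟩ := by
  rw [residueClass, dif_pos hc]

@[simp]
theorem residueClass_coe (c : 𝒪[K]) : residueClass (c : K) = IsLocalRing.residue 𝒪[K] c :=
  residueClass_of_mem c.2

theorem residue_eq_zero_iff_v_lt_one (c : 𝒪[K]) :
    IsLocalRing.residue 𝒪[K] c = 0 ↔ Valued.v (c : K) < 1 := by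
  rw [IsLocalRing.residue_eq_zero_iff]
  exact Valuation.mem_maximalIdeal_iff (v := Valued.v (R := K))

theorem residueClass_eq_zero_iff {c : K} (hc : c ∈ 𝒪[K]) :
    residueClass c = 0 ↔ Valued.v c < 1 := by
  rw [residueClass_of_mem hc, residue_eq_zero_iff_v_lt_one]

theorem residueClass_add {c d : K} (hc : c ∈ 𝒪[K]) (hd : d ∈ 𝒪[K]) :
    residueClass (c + d) = residueClass c + residueClass d := by
  rw [residueClass_of_mem hc, residueClass_of_mem hd, residueClass_of_mem (add_mem hc hd),
    ← map_add]
  rfl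

theorem residueClass_mul {c d : K} (hc : c ∈ 𝒪[K]) (hd : d ∈ 𝒪[K]) :
    residueClass (c * d) = residueClass c * residueClass d := by
  rw [residueClass_of_mem hc, residueClass_of_mem hd, residueClass_of_mem (mul_mem hc hd),
    ← map_mul]
  rfl

theorem residueClass_zero : residueClass (0 : K) = 0 := by
  have := residueClass_coe (0 : 𝒪[K])
  simpa using this

theorem v_uniformizer_mul_lt_one (hp : Valued.v p = WithZero.exp (-1 : ℤ)) (y : 𝒪[K]) :
    Valued.v (p * y) < 1 := by
  have hy : Valued.v (y : K) ≤ 1 := y.2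
  rw [map_mul]
  refine mul_lt_one_of_lt_of_le ?_ hy
  rw [hp, ← WithZero.exp_zero, WithZero.exp_lt_exp]
  lia

variable {R : Subring 𝒪[K]}

theorem exists_approx (hp : Valued.v p = WithZero.exp (-1 : ℤ)) (hR : Dense (R : Set 𝒪[K]))
    (c : 𝒪[K]) : ∃ r : R, ∃ d : 𝒪[K], (c : K) = ((r : 𝒪[K]) : K) + p * d := by
  have hopen : IsOpen {x : 𝒪[K] | Valued.v ((x : K) - c) < 1} := by
    have h1 : IsOpen {x : K | Valued.v x < 1} := by
      have := Valued.isOpen_ball K (1 : MonoidWithZeroHom.ValueGroup₀ (.ofClass (Valued.v (R := K))))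
      convert this using 3
      rw [Valuation.restrict_lt_iff_lt_embedding]
      simp
    exact h1.preimage (by fun_prop : Continuous fun x : 𝒪[K] => (x : K) - c)
  obtain ⟨r, hr, hrR⟩ := hR.exists_mem_open hopen ⟨c, by simp⟩
  obtain ⟨d, hd⟩ := exists_eq_mul_of_v_lt_one hp
    (show Valued.v ((c : K) - r) < 1 by rw [Valuation.map_sub_swap]; exact hrR)
  exact ⟨⟨r, hr⟩, d, by rw [← hd]; simp⟩

variable [CompleteSpace K]

theorem evalUniformizer_C (hp : Valued.v p = WithZero.exp (-1 : ℤ)) (r : R) :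
    evalUniformizer R p hp (PowerSeries.C r) = ((r : 𝒪[K]) : K) := by
  change ∑' β : ℕ, _ = _
  rw [tsum_eq_single 0]
  · simp
  · intro β hβ
    simp [PowerSeries.coeff_C, hβ]

theorem evalUniformizer_X (hp : Valued.v p = WithZero.exp (-1 : ℤ)) :
    evalUniformizer R p hp PowerSeries.X = p := by
  change ∑' β : ℕ, _ = _
  rw [tsum_eq_single 1]
  · simp
  · intro β hβ
    simp [PowerSeries.coeff_X, hβ]

theorem evalUniformizer_mem (hp : Valued.v p = WithZero.exp (-1 : ℤ)) (φ : PowerSeries R) :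
    evalUniformizer R p hp φ ∈ 𝒪[K] := by
  have hs := (summable_mul_pow hp (fun β => ((PowerSeries.coeff β φ : R) : 𝒪[K]))).hasSum
  refine (Valued.isClosed_integer K).mem_of_tendsto hs (Filter.Eventually.of_forall fun s => ?_)
  have hp' : p ∈ 𝒪[K] := by
    rw [mem_integer_iff, hp, ← WithZero.exp_zero, WithZero.exp_le_exp]
    lia
  exact sum_mem fun β _ => mul_mem (SetLike.coe_mem _) (pow_mem hp' _)

theorem exists_evalUniformizer_eq_add_mul (hp : Valued.v p = WithZero.exp (-1 : ℤ))
    (φ : PowerSeries R) : ∃ y : 𝒪[K],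
      evalUniformizer R p hp φ = ((PowerSeries.coeff 0 φ : R) : 𝒪[K]) + p * y := by
  refine ⟨⟨_, evalUniformizer_mem hp (PowerSeries.mk fun i => PowerSeries.coeff (i + 1) φ)⟩, ?_⟩
  conv_lhs => rw [PowerSeries.eq_X_mul_shift_add_const φ]
  rw [map_add, map_mul, evalUniformizer_X, evalUniformizer_C, add_comm]
  simp

theorem residueClass_evalUniformizer (hp : Valued.v p = WithZero.exp (-1 : ℤ))
    (φ : PowerSeries R) : residueClass (evalUniformizer R p hp φ) =
      IsLocalRing.residue 𝒪[K] (PowerSeries.coeff 0 φ : R) := by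
  obtain ⟨y, hy⟩ := exists_evalUniformizer_eq_add_mul hp φ
  have h1 := v_uniformizer_mul_lt_one hp y
  rw [hy, residueClass_add (SetLike.coe_mem _) (mem_integer_iff.2 h1.le), residueClass_coe,
    (residueClass_eq_zero_iff (mem_integer_iff.2 h1.le)).2 h1, add_zero]

/-- If the lowest coefficient of `φ` is a unit of the valuation ring, then it determines the
valuation and the angular component of `∑ c_β p ^ β`. -/
theorem evalUniformizer_of_unit_lowest (hp : Valued.v p = WithZero.exp (-1 : ℤ))
    {φ : PowerSeries R}
    (hφ : Valued.v (((PowerSeries.coeff φ.order.toNat φ : R) : 𝒪[K]) : K) = 1) :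
    evalUniformizer R p hp φ ≠ 0 ∧ val (evalUniformizer R p hp φ) = φ.order.toNat ∧
      residueClass (evalUniformizer R p hp φ * p ^ (-val (evalUniformizer R p hp φ))) =
        IsLocalRing.residue 𝒪[K] (PowerSeries.coeff φ.order.toNat φ : R) := by
  have hp0 := uniformizer_ne_zero hp
  set k := φ.order.toNat with hk
  set ψ := PowerSeries.divXPowOrder φ with hψ
  have hfac : evalUniformizer R p hp φ = p ^ k * evalUniformizer R p hp ψ := by
    conv_lhs => rw [← PowerSeries.X_pow_order_mul_divXPowOrder (f := φ)]
    rw [map_mul, map_pow, evalUniformizer_X]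
  have hc0 : PowerSeries.coeff 0 ψ = PowerSeries.coeff k φ := by
    rw [hψ, PowerSeries.coeff_divXPowOrder, zero_add]
  have hres := residueClass_evalUniformizer hp ψ
  rw [hc0] at hres
  have hv : Valued.v (evalUniformizer R p hp ψ) = 1 := by
    refine le_antisymm (evalUniformizer_mem hp ψ) (not_lt.1 fun hlt => ?_)
    rw [← residueClass_eq_zero_iff (evalUniformizer_mem hp ψ), hres,
      residue_eq_zero_iff_v_lt_one, hφ] at hlt
    exact lt_irrefl _ hlt
  have hval : Valued.v (evalUniformizer R p hp φ) = WithZero.exp (-(k : ℤ)) := by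
    rw [hfac, map_mul, hv, mul_one, ← zpow_natCast, v_zpow hp]
  have hval' := val_eq_of_v_eq hval
  refine ⟨fun h0 => WithZero.exp_ne_zero (by rw [← hval, h0, map_zero]), hval', ?_⟩
  rw [hval', hfac, ← hres]
  congr 1
  rw [zpow_neg, zpow_natCast]
  field_simp

/-- Density of `R` makes `R⟦t⟧ → 𝒪[K]`, `t ↦ p`, surjective: `p`-adic expansions have digits
in `R`. -/
theorem exists_evalUniformizer_eq (hp : Valued.v p = WithZero.exp (-1 : ℤ))
    (hR : Dense (R : Set 𝒪[K])) (c : 𝒪[K]) : ∃ φ : PowerSeries R, evalUniformizer R p hp φ = c := by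
  choose s d hsd using exists_approx hp hR
  let a : ℕ → 𝒪[K] := fun k => d^[k] c
  refine ⟨PowerSeries.mk fun k => s (a k), ?_⟩
  have hs := (summable_mul_pow hp (fun β => (s (a β) : 𝒪[K]))).hasSum.tendsto_sum_nat
  have hpart : ∀ k, ∑ β ∈ Finset.range k, ((s (a β) : 𝒪[K]) : K) * p ^ β = c - p ^ k * a k := by
    intro k
    induction k with
    | zero => simp [a]
    | succ k ih =>
      have h1 : a (k + 1) = d (a k) := Function.iterate_succ_apply' d k c
      rw [Finset.sum_range_succ, ih, h1, hsd (a k)]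
      ring
  have hz : Filter.Tendsto (fun k => (a k : K) * p ^ k) Filter.atTop (nhds 0) :=
    (summable_mul_pow hp a).tendsto_atTop_zero
  have hlim : Filter.Tendsto (fun k => (c : K) - p ^ k * a k) Filter.atTop (nhds (c : K)) := by
    simpa [mul_comm] using hz.const_sub (c : K)
  have h2 : evalUniformizer R p hp (PowerSeries.mk fun k => s (a k)) =
      ∑' β, ((s (a β) : 𝒪[K]) : K) * p ^ β := by
    change ∑' β, _ = _
    simp
  rw [h2]
  simp only [hpart] at hs
  exact tendsto_nhds_unique hs hlim

end Evaluation

/-! ### Leading terms over a coefficient ring -/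

section LeadingTerms

variable {n : ℕ} {A : Type*} [CommRing A] {w : ℝ × (Fin n → ℝ)}

theorem IsLeadingMonomial.unique {f : MvPolynomial (Fin n) (PowerSeries A)} {m m' : Mon n}
    (h : IsLeadingMonomial w f m) (h' : IsLeadingMonomial w f m') : m = m' := by
  by_contra hne
  exact WeightedLT.irrefl _ ((h.2 _ h'.1 (Ne.symm hne)).trans (h'.2 _ h.1 hne))

theorem IsLeadingMonomial.leadingTerm_eq {f : MvPolynomial (Fin n) (PowerSeries A)} {m : Mon n}
    (h : IsLeadingMonomial w f m) : leadingTerm w f = termAt f m := by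
  have hex : ∃ m, IsLeadingMonomial w f m := ⟨m, h⟩
  rw [leadingTerm, dif_pos hex, hex.choose_spec.unique h]

theorem leadingTerm_zero : leadingTerm w (0 : MvPolynomial (Fin n) (PowerSeries A)) = 0 := by
  rw [leadingTerm, dif_neg]
  rintro ⟨m, hm, -⟩
  exact hm (by simp [coeffAt])

theorem coeffAt_termAt (f : MvPolynomial (Fin n) (PowerSeries A)) (m m' : Mon n) :
    coeffAt (termAt f m) m' = if m' = m then coeffAt f m else 0 := by
  classical
  rcases m with ⟨β, α⟩
  rcases m' with ⟨β', α'⟩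
  simp only [coeffAt, termAt, MvPolynomial.coeff_monomial, Prod.mk.injEq]
  split_ifs with h1 h2 h3 <;> simp_all [PowerSeries.coeff_monomial]

theorem coeffAt_mul (f g : MvPolynomial (Fin n) (PowerSeries A)) (m : Mon n) :
    coeffAt (f * g) m = ∑ a ∈ Finset.HasAntidiagonal.antidiagonal m.2,
      ∑ b ∈ Finset.HasAntidiagonal.antidiagonal m.1, coeffAt f (b.1, a.1) * coeffAt g (b.2, a.2) := by
  simp only [coeffAt, MvPolynomial.coeff_mul, map_sum, PowerSeries.coeff_mul]

/-- The lowest monomial `t ^ β * x ^ α` occurring in the coefficient of `x ^ α` in `f`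
(with the junk value `β = 0` if that coefficient vanishes). -/
def lowestMon (f : MvPolynomial (Fin n) (PowerSeries A)) (α : Fin n →₀ ℕ) : Mon n :=
  ((MvPolynomial.coeff α f).order.toNat, α)

theorem coeffAt_lowestMon_ne_zero {f : MvPolynomial (Fin n) (PowerSeries A)} {α : Fin n →₀ ℕ}
    (h : MvPolynomial.coeff α f ≠ 0) : coeffAt f (lowestMon f α) ≠ 0 :=
  PowerSeries.coeff_order h

theorem coeff_ne_zero_of_coeffAt_ne_zero {f : MvPolynomial (Fin n) (PowerSeries A)} {m : Mon n}
    (h : coeffAt f m ≠ 0) : MvPolynomial.coeff m.2 f ≠ 0 :=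
  MvPolynomial.mem_support_iff.1 (order_le_of_coeffAt_ne_zero h).1

theorem weight_lt_weight_lowestMon (hw : w.1 < 0) {f : MvPolynomial (Fin n) (PowerSeries A)}
    {m : Mon n} (h : coeffAt f m ≠ 0) (hne : m ≠ lowestMon f m.2) :
    weight w m < weight w (lowestMon f m.2) := by
  obtain ⟨-, h2, -⟩ := order_le_of_coeffAt_ne_zero h
  have h3 : (MvPolynomial.coeff m.2 f).order.toNat < m.1 :=
    lt_of_le_of_ne h2 fun h4 => hne (Prod.ext h4.symm rfl)
  simp only [weight, lowestMon, add_lt_add_iff_right]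
  exact mul_lt_mul_of_neg_left (by exact_mod_cast h3) hw

theorem IsLeadingMonomial.eq_lowestMon (hw : w.1 < 0)
    {f : MvPolynomial (Fin n) (PowerSeries A)} {m : Mon n} (h : IsLeadingMonomial w f m) :
    m = lowestMon f m.2 := by
  by_contra hne
  exact WeightedLT.irrefl m (WeightedLT.trans (Or.inl (weight_lt_weight_lowestMon hw h.1 hne))
    (h.2 _ (coeffAt_lowestMon_ne_zero (coeff_ne_zero_of_coeffAt_ne_zero h.1)) (Ne.symm hne)))

theorem coeff_truncation (f : MvPolynomial (Fin n) (PowerSeries A)) (α : Fin n →₀ ℕ) :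
    MvPolynomial.coeff α (truncation f) = lowestTerm (MvPolynomial.coeff α f) := by
  classical
  simp only [truncation, MvPolynomial.coeff_sum, MvPolynomial.coeff_monomial]
  rw [Finset.sum_ite_eq' f.support α fun γ => lowestTerm (MvPolynomial.coeff γ f)]
  split_ifs with h
  · rfl
  · rw [MvPolynomial.notMem_support_iff.1 h]
    simp [lowestTerm]

theorem coeffAt_truncation (f : MvPolynomial (Fin n) (PowerSeries A)) (m : Mon n) :
    coeffAt (truncation f) m = if m = lowestMon f m.2 then coeffAt f m else 0 := by
  classical
  rcases m with ⟨β, α⟩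
  simp only [coeffAt, coeff_truncation, lowestTerm, PowerSeries.coeff_monomial, lowestMon,
    Prod.mk.injEq, and_true]
  split_ifs with h
  · rw [h]
  · rfl

theorem IsLeadingMonomial.truncation (hw : w.1 < 0) {f : MvPolynomial (Fin n) (PowerSeries A)}
    {m : Mon n} (h : IsLeadingMonomial w f m) : IsLeadingMonomial w (truncation f) m := by
  refine ⟨?_, fun m' hm' hne => h.2 m' ?_ hne⟩
  · rw [coeffAt_truncation, if_pos (h.eq_lowestMon hw)]
    exact h.1
  · rw [coeffAt_truncation] at hm'
    exact (ite_ne_right_iff.1 hm').2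

theorem IsLeadingMonomial.leadingTerm_truncation (hw : w.1 < 0)
    {f : MvPolynomial (Fin n) (PowerSeries A)} {m : Mon n} (h : IsLeadingMonomial w f m) :
    leadingTerm w (ValuedStandardBases.truncation f) = leadingTerm w f := by
  rw [(h.truncation hw).leadingTerm_eq, h.leadingTerm_eq, termAt, termAt, coeffAt_truncation,
    if_pos (h.eq_lowestMon hw)]

theorem leadingTerm_truncation (hw : w.1 < 0) (f : MvPolynomial (Fin n) (PowerSeries A)) :
    leadingTerm w (truncation f) = leadingTerm w f := by
  rcases eq_or_ne f 0 with rfl | hf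
  · have : truncation (0 : MvPolynomial (Fin n) (PowerSeries A)) = 0 := by simp [truncation]
    rw [this]
  · obtain ⟨m, hm, -⟩ := existsUnique_isLeadingMonomial hw hf
    exact hm.leadingTerm_truncation hw

theorem leadingIdeal_image_truncation (hw : w.1 < 0)
    (S : Set (MvPolynomial (Fin n) (PowerSeries A))) :
    leadingIdeal w (truncation '' S) = leadingIdeal w S := by
  simp only [leadingIdeal, Set.image_image, leadingTerm_truncation hw]

theorem leadingTerm_mem_leadingIdeal {S : Set (MvPolynomial (Fin n) (PowerSeries A))}
    {f : MvPolynomial (Fin n) (PowerSeries A)} (hf : f ∈ S) :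
    leadingTerm w f ∈ leadingIdeal w S :=
  Ideal.subset_span ⟨f, hf, rfl⟩

/-- The leading coefficients of those elements of `S` whose leading monomial divides `m`. -/
def leadingCoeffsDividing (w : ℝ × (Fin n → ℝ)) (S : Set (MvPolynomial (Fin n) (PowerSeries A)))
    (m : Mon n) : Set A :=
  {c | ∃ g ∈ S, ∃ m', IsLeadingMonomial w g m' ∧ m' ≤ m ∧ coeffAt g m' = c}

/-- A leading ideal is spanned by terms, so membership in it can be tested monomial by monomial,
inside the coefficient ring. -/
theorem coeffAt_mem_span_of_mem_leadingIdeal {S : Set (MvPolynomial (Fin n) (PowerSeries A))}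
    {h : MvPolynomial (Fin n) (PowerSeries A)} (hh : h ∈ leadingIdeal w S) (m : Mon n) :
    coeffAt h m ∈ Ideal.span (leadingCoeffsDividing w S m) := by
  classical
  induction hh using Submodule.span_induction generalizing m with
  | mem x hx =>
    obtain ⟨g, hg, rfl⟩ := hx
    by_cases hex : ∃ m, IsLeadingMonomial w g m
    · obtain ⟨m', hm'⟩ := hex
      rw [hm'.leadingTerm_eq, coeffAt_termAt]
      split_ifs with h
      · exact Ideal.subset_span ⟨g, hg, m', hm', h.ge, rfl⟩
      · exact zero_mem _
    · rw [leadingTerm, dif_neg hex]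
      simp [coeffAt]
  | zero => simp [coeffAt]
  | add x y _ _ hx hy =>
    have : coeffAt (x + y) m = coeffAt x m + coeffAt y m := by simp [coeffAt]
    rw [this]
    exact add_mem (hx m) (hy m)
  | smul q x _ hx =>
    rw [smul_eq_mul, coeffAt_mul]
    refine sum_mem fun a ha => sum_mem fun b hb => Ideal.mul_mem_left _ _ ?_
    refine Ideal.span_mono ?_ (hx (b.2, a.2))
    rintro c ⟨g, hg, m', hm', hle, rfl⟩
    refine ⟨g, hg, m', hm', hle.trans ⟨?_, ?_⟩, rfl⟩
    · exact Finset.HasAntidiagonal.antidiagonal.snd_le hb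
    · exact Finset.HasAntidiagonal.antidiagonal.snd_le ha

theorem termAt_eq_C_mul (f : MvPolynomial (Fin n) (PowerSeries A)) (m : Mon n) :
    termAt f m = MvPolynomial.C (PowerSeries.C (coeffAt f m)) *
      MvPolynomial.monomial m.2 (PowerSeries.monomial m.1 1) := by
  rw [MvPolynomial.C_mul_monomial, termAt, ← PowerSeries.monomial_zero_eq_C_apply,
    PowerSeries.monomial_mul_monomial, zero_add, mul_one]

theorem termAt_mem_of_C_mem {J : Ideal (MvPolynomial (Fin n) (PowerSeries A))}
    {f : MvPolynomial (Fin n) (PowerSeries A)} {m : Mon n}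
    (h : MvPolynomial.C (PowerSeries.C (coeffAt f m)) ∈ J) : termAt f m ∈ J := by
  rw [termAt_eq_C_mul]
  exact Ideal.mul_mem_right _ _ h

theorem termAt_zero (f : MvPolynomial (Fin n) (PowerSeries A)) :
    termAt f 0 = MvPolynomial.C (PowerSeries.C (coeffAt f 0)) := by
  rw [termAt_eq_C_mul]
  simp

/-- If a constant `c` lies in the leading ideal of `S`, then it already lies in the ideal generated
by the leading terms of the elements of `S` whose leading monomial is `1`. -/
theorem C_mem_leadingIdeal_of_subset {S T : Set (MvPolynomial (Fin n) (PowerSeries A))}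
    {c : A} (hc : MvPolynomial.C (PowerSeries.C c) ∈ leadingIdeal w S)
    (hST : ∀ g ∈ S, IsLeadingMonomial w g 0 → g ∈ T) :
    MvPolynomial.C (PowerSeries.C c) ∈ leadingIdeal w T := by
  have h1 := coeffAt_mem_span_of_mem_leadingIdeal hc 0
  have h2 :
      coeffAt (MvPolynomial.C (PowerSeries.C c) : MvPolynomial (Fin n) (PowerSeries A)) 0 = c := by
    simp [coeffAt]
  rw [h2] at h1
  have h3 := Ideal.mem_map_of_mem ((MvPolynomial.C (σ := Fin n)).comp (PowerSeries.C (R := A))) h1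
  rw [Ideal.map_span] at h3
  refine Ideal.span_le.2 ?_ h3
  rintro _ ⟨_, ⟨g, hg, m', hm', hle, rfl⟩, rfl⟩
  obtain rfl : m' = 0 := le_antisymm hle ⟨Nat.zero_le _, zero_le⟩
  have h4 := leadingTerm_mem_leadingIdeal (w := w) (hST g hg hm')
  rw [hm'.leadingTerm_eq, termAt_zero] at h4
  exact h4

open Classical in
theorem initialForm_eq_sum (hw : w.1 < 0) (f : MvPolynomial (Fin n) (PowerSeries A)) :
    initialForm w f = ∑ α ∈ f.support with lowestMon f α ∈ initialSupport w f,
      MvPolynomial.monomial α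
        (Polynomial.monomial (lowestMon f α).1 (coeffAt f (lowestMon f α))) := by
  have hset : initialSupport w f = lowestMon f ''
      ((f.support.filter fun α => lowestMon f α ∈ initialSupport w f :
        Finset (Fin n →₀ ℕ)) : Set (Fin n →₀ ℕ)) := by
    ext m
    constructor
    · intro hm
      have heq : m = lowestMon f m.2 := by
        by_contra hne
        exact (weight_lt_weight_lowestMon hw hm.1 hne).not_ge (hm.2 _
          (coeffAt_lowestMon_ne_zero (coeff_ne_zero_of_coeffAt_ne_zero hm.1)))
      refine ⟨m.2, ?_, heq.symm⟩
      rw [Finset.mem_coe, Finset.mem_filter, ← heq]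
      exact ⟨(order_le_of_coeffAt_ne_zero hm.1).1, hm⟩
    · rintro ⟨α, hα, rfl⟩
      exact (Finset.mem_filter.1 hα).2
  rw [initialForm]
  conv_lhs => rw [hset]
  rw [finsum_mem_image, finsum_mem_coe_finset]
  · rfl
  · intro α _ γ _ h
    exact congrArg Prod.snd h

end LeadingTerms

/-! ### Leading exponents over the valued field and lifting to `R⟦t⟧[x]` -/

section ValuedLeading

variable {K : Type*} [Field K] [Valued K ℤᵐ⁰] {p : K} {n : ℕ} {w : Fin n → ℝ}

/-- `x ^ α` is the lexicographically largest monomial among those of maximal valued weight in `f`,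
i.e. the leading monomial of `in_{ν,w}(f)`. -/
def IsValuedLeading (w : Fin n → ℝ) (f : MvPolynomial (Fin n) K) (α : Fin n →₀ ℕ) : Prop :=
  MvPolynomial.coeff α f ≠ 0 ∧ ∀ γ, MvPolynomial.coeff γ f ≠ 0 → γ ≠ α →
    valuedWeight w f γ < valuedWeight w f α ∨
      (valuedWeight w f γ = valuedWeight w f α ∧ toLex γ < toLex α)

theorem IsValuedLeading.unique {f : MvPolynomial (Fin n) K} {α γ : Fin n →₀ ℕ}
    (h : IsValuedLeading w f α) (h' : IsValuedLeading w f γ) : α = γ := by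
  by_contra hne
  rcases h.2 γ h'.1 (Ne.symm hne) with h1 | ⟨h1, h2⟩ <;>
    rcases h'.2 α h.1 hne with h3 | ⟨h3, h4⟩
  · exact lt_asymm h1 h3
  · exact h1.ne' h3
  · exact h3.ne' h1
  · exact lt_asymm h2 h4

theorem IsValuedLeading.valuedWeight_le {f : MvPolynomial (Fin n) K} {α γ : Fin n →₀ ℕ}
    (h : IsValuedLeading w f α) (hγ : MvPolynomial.coeff γ f ≠ 0) :
    valuedWeight w f γ ≤ valuedWeight w f α := by
  by_cases hne : γ = α
  · rw [hne]
  · rcases h.2 γ hγ hne with h1 | h1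
    · exact h1.le
    · exact h1.1.le

theorem valuedWeight_C_mul {c : K} (hc : c ≠ 0) {f : MvPolynomial (Fin n) K} {γ : Fin n →₀ ℕ}
    (hγ : MvPolynomial.coeff γ f ≠ 0) :
    valuedWeight w (MvPolynomial.C c * f) γ = valuedWeight w f γ - val c := by
  simp only [valuedWeight, MvPolynomial.coeff_C_mul, val_mul hc hγ]
  push_cast
  ring

theorem isValuedLeading_C_mul_iff {c : K} (hc : c ≠ 0) {f : MvPolynomial (Fin n) K}
    {α : Fin n →₀ ℕ} :
    IsValuedLeading w (MvPolynomial.C c * f) α ↔ IsValuedLeading w f α := by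
  have h0 : ∀ γ, MvPolynomial.coeff γ (MvPolynomial.C c * f) ≠ 0 ↔ MvPolynomial.coeff γ f ≠ 0 := by
    intro γ
    simp [MvPolynomial.coeff_C_mul, hc]
  simp only [IsValuedLeading, h0]
  refine and_congr_right fun hα => forall_congr' fun γ => imp_congr_right fun hγ => ?_
  rw [valuedWeight_C_mul hc hα, valuedWeight_C_mul hc hγ]
  simp

open Classical in
theorem coeff_valuedInitialForm (f : MvPolynomial (Fin n) K) (γ : Fin n →₀ ℕ) :
    MvPolynomial.coeff γ (valuedInitialForm p w f) =
      if MvPolynomial.coeff γ f ≠ 0 ∧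
          ∀ δ, MvPolynomial.coeff δ f ≠ 0 → valuedWeight w f δ ≤ valuedWeight w f γ
      then residueClass (MvPolynomial.coeff γ f * p ^ (-val (MvPolynomial.coeff γ f))) else 0 := by
  simp only [valuedInitialForm, MvPolynomial.coeff_sum, MvPolynomial.coeff_monomial]
  rw [Finset.sum_ite_eq']
  simp only [Finset.mem_filter, MvPolynomial.mem_support_iff]

theorem residueClass_mul_zpow_neg_val_ne_zero (hp : Valued.v p = WithZero.exp (-1 : ℤ)) {c : K}
    (hc : c ≠ 0) : residueClass (c * p ^ (-val c)) ≠ 0 := by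
  rw [Ne, residueClass_eq_zero_iff (mul_zpow_mem_integer hp hc), v_mul_zpow_neg_val hp hc]
  exact lt_irrefl _

theorem degree_eq_of_isMax {k : Type*} [Field k] {h : MvPolynomial (Fin n) k} {α : Fin n →₀ ℕ}
    (hα : MvPolynomial.coeff α h ≠ 0)
    (hmax : ∀ γ, MvPolynomial.coeff γ h ≠ 0 → γ ≠ α → toLex γ < toLex α) :
    (MonomialOrder.lex (σ := Fin n)).degree h = α := by
  by_contra hne
  have h0 : h ≠ 0 := by
    rintro rfl
    simp at hα
  have h1 := hmax _ (MonomialOrder.coeff_degree_ne_zero_iff.2 h0) hne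
  have h2 := (MonomialOrder.lex (σ := Fin n)).le_degree (MvPolynomial.mem_support_iff.2 hα)
  rw [MonomialOrder.lex_le_iff] at h2
  exact h1.not_ge h2

theorem IsValuedLeading.coeff_valuedInitialForm_ne_zero
    (hp : Valued.v p = WithZero.exp (-1 : ℤ)) {f : MvPolynomial (Fin n) K} {α : Fin n →₀ ℕ}
    (h : IsValuedLeading w f α) : MvPolynomial.coeff α (valuedInitialForm p w f) ≠ 0 := by
  rw [coeff_valuedInitialForm, if_pos ⟨h.1, fun δ hδ => h.valuedWeight_le hδ⟩]
  exact residueClass_mul_zpow_neg_val_ne_zero hp h.1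

theorem IsValuedLeading.degree_valuedInitialForm
    (hp : Valued.v p = WithZero.exp (-1 : ℤ)) {f : MvPolynomial (Fin n) K} {α : Fin n →₀ ℕ}
    (h : IsValuedLeading w f α) :
    (MonomialOrder.lex (σ := Fin n)).degree (valuedInitialForm p w f) = α := by
  refine degree_eq_of_isMax (h.coeff_valuedInitialForm_ne_zero hp) fun γ hγ hne => ?_
  classical
  rw [coeff_valuedInitialForm] at hγ
  obtain ⟨⟨hγ0, hγ1⟩, -⟩ := ite_ne_right_iff.1 hγ
  rcases h.2 γ hγ0 hne with h1 | h1
  · exact absurd (hγ1 α h.1) h1.not_ge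
  · exact h1.2

theorem exists_C_mul_coeff_mem_integer (hp : Valued.v p = WithZero.exp (-1 : ℤ))
    (f : MvPolynomial (Fin n) K) : ∃ c : K, c ≠ 0 ∧
      ∀ α, MvPolynomial.coeff α (MvPolynomial.C c * f) ∈ 𝒪[K] := by
  classical
  obtain ⟨k, hk⟩ := Finset.exists_le (f.support.image fun α => -val (MvPolynomial.coeff α f))
  refine ⟨p ^ k, zpow_ne_zero _ (uniformizer_ne_zero hp), fun α => ?_⟩
  rw [MvPolynomial.coeff_C_mul]
  by_cases h0 : MvPolynomial.coeff α f = 0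
  · rw [h0, mul_zero]
    exact zero_mem _
  · have h1 := hk _ (Finset.mem_image_of_mem _ (MvPolynomial.mem_support_iff.2 h0))
    rw [mem_integer_iff, map_mul, v_zpow hp, v_eq_exp_neg_val h0, ← WithZero.exp_add,
      ← WithZero.exp_zero, WithZero.exp_le_exp]
    lia

section Lifting

variable {R : Subring 𝒪[K]}

/-- All lowest coefficients of the power series coefficients of `g` are units of the valuation
ring. -/
def HasUnitLowest (g : MvPolynomial (Fin n) (PowerSeries R)) : Prop :=
  ∀ α, MvPolynomial.coeff α g ≠ 0 →
    Valued.v (((coeffAt g (lowestMon g α) : R) : 𝒪[K]) : K) = 1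

theorem lowestMon_mem_initialSupport_iff (g : MvPolynomial (Fin n) (PowerSeries R))
    {α : Fin n →₀ ℕ} (hα : MvPolynomial.coeff α g ≠ 0) :
    lowestMon g α ∈ initialSupport ((-1 : ℝ), w) g ↔ ∀ δ, MvPolynomial.coeff δ g ≠ 0 →
      weight ((-1 : ℝ), w) (lowestMon g δ) ≤ weight ((-1 : ℝ), w) (lowestMon g α) := by
  constructor
  · exact fun h δ hδ => h.2 _ (coeffAt_lowestMon_ne_zero hδ)
  · refine fun h => ⟨coeffAt_lowestMon_ne_zero hα, fun m hm => ?_⟩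
    refine le_trans ?_ (h m.2 (coeff_ne_zero_of_coeffAt_ne_zero hm))
    by_cases hne : m = lowestMon g m.2
    · rw [← hne]
    · exact (weight_lt_weight_lowestMon (by norm_num) hm hne).le

variable [CompleteSpace K] {hp : Valued.v p = WithZero.exp (-1 : ℤ)}

theorem coeff_projection (g : MvPolynomial (Fin n) (PowerSeries R)) (α : Fin n →₀ ℕ) :
    MvPolynomial.coeff α (projection R p hp g) =
      evalUniformizer R p hp (MvPolynomial.coeff α g) :=
  MvPolynomial.coeff_map _ _ _

theorem HasUnitLowest.coeff_projection_ne_zero_iff {g : MvPolynomial (Fin n) (PowerSeries R)}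
    (hg : HasUnitLowest g) (α : Fin n →₀ ℕ) :
    MvPolynomial.coeff α (projection R p hp g) ≠ 0 ↔ MvPolynomial.coeff α g ≠ 0 := by
  rw [coeff_projection]
  refine ⟨fun h h0 => h (by rw [h0, map_zero]), fun h => ?_⟩
  exact (evalUniformizer_of_unit_lowest hp (hg α h)).1

theorem HasUnitLowest.valuedWeight_projection {g : MvPolynomial (Fin n) (PowerSeries R)}
    (hg : HasUnitLowest g) {α : Fin n →₀ ℕ} (hα : MvPolynomial.coeff α g ≠ 0) :
    valuedWeight w (projection R p hp g) α = weight ((-1 : ℝ), w) (lowestMon g α) := by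
  rw [valuedWeight, coeff_projection, (evalUniformizer_of_unit_lowest hp (hg α hα)).2.1]
  simp only [weight, lowestMon]
  push_cast
  ring

/-- Taking initial forms commutes with `π` for elements with unit lowest coefficients. -/
theorem HasUnitLowest.residueAtOne_initialForm {g : MvPolynomial (Fin n) (PowerSeries R)}
    (hg : HasUnitLowest g) : residueAtOne R (initialForm ((-1 : ℝ), w) g) =
      valuedInitialForm p w (projection R p hp g) := by
  classical
  rw [initialForm_eq_sum (by norm_num), map_sum, valuedInitialForm]
  refine Finset.sum_congr ?_ fun α hα => ?_
  · ext α
    simp only [Finset.mem_filter, MvPolynomial.mem_support_iff, hg.coeff_projection_ne_zero_iff]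
    refine and_congr_right fun hα => ?_
    rw [lowestMon_mem_initialSupport_iff g hα]
    refine forall_congr' fun δ => imp_congr_right fun hδ => ?_
    rw [hg.valuedWeight_projection hα, hg.valuedWeight_projection hδ]
  · have hα0 : MvPolynomial.coeff α g ≠ 0 := by
      rw [← hg.coeff_projection_ne_zero_iff (hp := hp)]
      exact MvPolynomial.mem_support_iff.1 (Finset.mem_filter.1 hα).1
    rw [coeff_projection, (evalUniformizer_of_unit_lowest hp (hg α hα0)).2.2, residueAtOne,
      MvPolynomial.map_monomial]
    congr 1
    simp [coeffAt, lowestMon, Polynomial.eval_monomial]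

theorem HasUnitLowest.isValuedLeading {g : MvPolynomial (Fin n) (PowerSeries R)}
    (hg : HasUnitLowest g) {m : Mon n} (hm : IsLeadingMonomial ((-1 : ℝ), w) g m) :
    IsValuedLeading w (projection R p hp g) m.2 := by
  have hm0 := coeff_ne_zero_of_coeffAt_ne_zero hm.1
  have hml := hm.eq_lowestMon (by norm_num)
  refine ⟨(hg.coeff_projection_ne_zero_iff _).2 hm0, fun γ hγ hne => ?_⟩
  rw [hg.coeff_projection_ne_zero_iff] at hγ
  rw [hg.valuedWeight_projection hγ, hg.valuedWeight_projection hm0, ← hml]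
  rcases hm.2 _ (coeffAt_lowestMon_ne_zero hγ) (fun h => hne (by rw [← h]; rfl)) with
    h | ⟨h1, h2 | h2⟩
  · exact Or.inl h
  · exact Or.inr ⟨h1, h2⟩
  · exact absurd h2.1 hne

theorem exists_unitLowest_evalUniformizer_eq (hp : Valued.v p = WithZero.exp (-1 : ℤ))
    (hR : Dense (R : Set 𝒪[K])) {c : K} (hc0 : c ≠ 0)
    (hc : c ∈ 𝒪[K]) : ∃ φ : PowerSeries R, evalUniformizer R p hp φ = c ∧
      Valued.v (((PowerSeries.coeff φ.order.toNat φ : R) : 𝒪[K]) : K) = 1 := by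
  have hp0 := uniformizer_ne_zero hp
  have hval : 0 ≤ val c := by
    have h1 : Valued.v c ≤ 1 := hc
    rw [v_eq_exp_neg_val hc0, ← WithZero.exp_zero, WithZero.exp_le_exp] at h1
    lia
  obtain ⟨k, hk⟩ := Int.eq_ofNat_of_zero_le hval
  obtain ⟨φ, hφ⟩ := exists_evalUniformizer_eq hp hR ⟨_, mul_zpow_mem_integer hp hc0⟩
  have hu : Valued.v (((PowerSeries.coeff 0 φ : R) : 𝒪[K]) : K) = 1 := by
    refine le_antisymm (SetLike.coe_mem ((PowerSeries.coeff 0 φ : R) : 𝒪[K]))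
      (not_lt.1 fun hlt => ?_)
    rw [← residue_eq_zero_iff_v_lt_one, ← residueClass_evalUniformizer hp φ, hφ] at hlt
    exact residueClass_mul_zpow_neg_val_ne_zero hp hc0 hlt
  have hne : PowerSeries.coeff 0 φ ≠ 0 := by
    intro h
    rw [h] at hu
    simp at hu
  have hord : (PowerSeries.X ^ k * φ).order = (k : ℕ∞) := by
    refine PowerSeries.order_eq_nat.2 ⟨?_, fun i hi => ?_⟩
    · rwa [PowerSeries.coeff_X_pow_mul', if_pos le_rfl, Nat.sub_self]
    · rw [PowerSeries.coeff_X_pow_mul', if_neg (by lia)]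
  refine ⟨PowerSeries.X ^ k * φ, ?_, ?_⟩
  · rw [map_mul, map_pow, evalUniformizer_X, hφ]
    simp only [hk, zpow_neg, zpow_natCast]
    field_simp
  · rw [hord, ENat.toNat_natCast, PowerSeries.coeff_X_pow_mul', if_pos le_rfl, Nat.sub_self]
    exact hu

theorem exists_hasUnitLowest_lift (hp : Valued.v p = WithZero.exp (-1 : ℤ))
    (hR : Dense (R : Set 𝒪[K])) {f : MvPolynomial (Fin n) K}
    (hf : ∀ α, MvPolynomial.coeff α f ∈ 𝒪[K]) :
    ∃ F : MvPolynomial (Fin n) (PowerSeries R), projection R p hp F = f ∧ HasUnitLowest F := by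
  classical
  have hex : ∀ α, ∃ φ : PowerSeries R, evalUniformizer R p hp φ = MvPolynomial.coeff α f ∧
      (MvPolynomial.coeff α f ≠ 0 →
        Valued.v (((PowerSeries.coeff φ.order.toNat φ : R) : 𝒪[K]) : K) = 1) := by
    intro α
    by_cases h0 : MvPolynomial.coeff α f = 0
    · exact ⟨0, by rw [h0, map_zero], fun h => absurd h0 h⟩
    · obtain ⟨φ, h1, h2⟩ := exists_unitLowest_evalUniformizer_eq hp hR h0 (hf α)
      exact ⟨φ, h1, fun _ => h2⟩
  choose φ hφ1 hφ2 using hex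
  have hcoeff : ∀ α, MvPolynomial.coeff α (∑ γ ∈ f.support, MvPolynomial.monomial γ (φ γ)) =
      if MvPolynomial.coeff α f ≠ 0 then φ α else 0 := by
    intro α
    simp only [MvPolynomial.coeff_sum, MvPolynomial.coeff_monomial]
    rw [Finset.sum_ite_eq']
    simp only [MvPolynomial.mem_support_iff]
  refine ⟨∑ γ ∈ f.support, MvPolynomial.monomial γ (φ γ), ?_, fun α hα => ?_⟩
  · ext α
    rw [coeff_projection, hcoeff]
    split_ifs with h
    · exact hφ1 α
    · rw [map_zero, not_not.1 h]
  · have h0 : MvPolynomial.coeff α f ≠ 0 := by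
      rw [hcoeff] at hα
      exact (ite_ne_right_iff.1 hα).1
    simp only [coeffAt, lowestMon, hcoeff, if_pos h0]
    exact hφ2 α h0

/-- Up to a scalar, every nonzero `f ∈ K[x]` lifts to `R⟦t⟧[x]`, and the leading monomial of the
lift exhibits the leading monomial of `in_{ν,w}(f)`. -/
theorem exists_lift_isLeadingMonomial (hp : Valued.v p = WithZero.exp (-1 : ℤ))
    (hR : Dense (R : Set 𝒪[K])) (w : Fin n → ℝ) {f : MvPolynomial (Fin n) K} (hf : f ≠ 0) :
    ∃ (c : K) (F : MvPolynomial (Fin n) (PowerSeries R)) (m : Mon n), c ≠ 0 ∧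
      projection R p hp F = MvPolynomial.C c * f ∧ HasUnitLowest F ∧
      IsLeadingMonomial ((-1 : ℝ), w) F m ∧ IsValuedLeading w f m.2 := by
  obtain ⟨c, hc, hint⟩ := exists_C_mul_coeff_mem_integer hp f
  obtain ⟨F, hF, hFu⟩ := exists_hasUnitLowest_lift hp hR hint
  have hF0 : F ≠ 0 := by
    rintro rfl
    rw [map_zero] at hF
    exact mul_ne_zero (by simpa using hc) hf hF.symm
  obtain ⟨m, hm, -⟩ :=
    existsUnique_isLeadingMonomial (w := ((-1 : ℝ), w)) (by norm_num) hF0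
  refine ⟨c, F, m, hc, hF, hFu, hm, ?_⟩
  rw [← isValuedLeading_C_mul_iff hc, ← hF]
  exact hFu.isValuedLeading hm

end Lifting

end ValuedLeading

/-! ### Leading monomials of the initial ideal -/

section InitialIdeal

variable {K : Type*} [Field K] [Valued K ℤᵐ⁰] {p : K} {n : ℕ} {w : Fin n → ℝ}

/-- `f` represents the `θ`-component of `h`: all terms of `f` have valued weight at most `θ`, and
at the exponents `α` with `w · α ∈ θ + ℤ` the coefficient of `h` is the residue of the suitably
scaled coefficient of `f` (hence zero unless the term of `f` at `α` has valued weight `θ`).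
Unlike initial forms, this relation is additive in `(f, h)`. -/
def Represents (p : K) (w : Fin n → ℝ) (θ : ℝ) (f : MvPolynomial (Fin n) K)
    (h : MvPolynomial (Fin n) 𝓀[K]) : Prop :=
  (∀ α, Valued.v (MvPolynomial.coeff α f) ≤ WithZero.exp (-⌈∑ i, w i * α i - θ⌉)) ∧
    ∀ (α : Fin n →₀ ℕ) (k : ℤ), ∑ i, w i * α i - θ = k →
      residueClass (MvPolynomial.coeff α f * p ^ (-k)) = MvPolynomial.coeff α h

theorem mul_zpow_neg_mem (hp : Valued.v p = WithZero.exp (-1 : ℤ)) {c : K} {k : ℤ}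
    (hc : Valued.v c ≤ WithZero.exp (-k)) : c * p ^ (-k) ∈ 𝒪[K] := by
  rw [mem_integer_iff, map_mul, v_zpow hp, neg_neg]
  refine (mul_le_mul_left hc _).trans ?_
  rw [← WithZero.exp_add, neg_add_cancel, WithZero.exp_zero]

theorem Represents.mul_zpow_mem (hp : Valued.v p = WithZero.exp (-1 : ℤ)) {θ : ℝ}
    {f : MvPolynomial (Fin n) K} {h : MvPolynomial (Fin n) 𝓀[K]} (hf : Represents p w θ f h)
    {α : Fin n →₀ ℕ} {k : ℤ} (hk : ∑ i, w i * α i - θ = k) :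
    MvPolynomial.coeff α f * p ^ (-k) ∈ 𝒪[K] := by
  have h1 := hf.1 α
  rw [hk, Int.ceil_intCast] at h1
  exact mul_zpow_neg_mem hp h1

theorem Represents.zero (θ : ℝ) : Represents p w θ 0 0 :=
  ⟨fun α => by simp, fun α k _ => by simp [residueClass_zero]⟩

theorem Represents.add (hp : Valued.v p = WithZero.exp (-1 : ℤ)) {θ : ℝ}
    {f f' : MvPolynomial (Fin n) K} {h h' : MvPolynomial (Fin n) 𝓀[K]}
    (hf : Represents p w θ f h) (hf' : Represents p w θ f' h') :
    Represents p w θ (f + f') (h + h') := by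
  refine ⟨fun α => ?_, fun α k hk => ?_⟩
  · rw [MvPolynomial.coeff_add]
    exact Valuation.map_add_le _ (hf.1 α) (hf'.1 α)
  · rw [MvPolynomial.coeff_add, MvPolynomial.coeff_add, add_mul,
      residueClass_add (hf.mul_zpow_mem hp hk) (hf'.mul_zpow_mem hp hk), hf.2 α k hk, hf'.2 α k hk]

theorem sum_mul_add (w : Fin n → ℝ) (a γ : Fin n →₀ ℕ) :
    ∑ i, w i * ((a + γ) i : ℕ) = ∑ i, w i * a i + ∑ i, w i * γ i := by
  rw [← Finset.sum_add_distrib]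
  refine Finset.sum_congr rfl fun i _ => ?_
  rw [Finsupp.add_apply]
  push_cast
  ring

theorem Represents.monomial_mul (hp : Valued.v p = WithZero.exp (-1 : ℤ)) {θ : ℝ}
    {f : MvPolynomial (Fin n) K} {h : MvPolynomial (Fin n) 𝓀[K]} {a : Fin n →₀ ℕ} (r : 𝒪[K])
    (hf : Represents p w (θ - ∑ i, w i * a i) f h) :
    Represents p w θ (MvPolynomial.monomial a (r : K) * f)
      (MvPolynomial.monomial a (IsLocalRing.residue 𝒪[K] r) * h) := by
  have hshift : ∀ γ : Fin n →₀ ℕ, ∑ i, w i * ((a + γ) i : ℕ) - θ =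
      ∑ i, w i * γ i - (θ - ∑ i, w i * a i) := by
    intro γ
    rw [sum_mul_add]
    ring
  refine ⟨fun α => ?_, fun α k hk => ?_⟩
  · rw [MvPolynomial.coeff_monomial_mul']
    split_ifs with hle
    · obtain ⟨γ, rfl⟩ := exists_add_of_le hle
      rw [add_tsub_cancel_left, hshift, map_mul]
      exact (mul_le_of_le_one_left' r.2).trans (hf.1 γ)
    · rw [map_zero]
      exact zero_le
  · rw [MvPolynomial.coeff_monomial_mul', MvPolynomial.coeff_monomial_mul']
    split_ifs with hle
    · obtain ⟨γ, rfl⟩ := exists_add_of_le hle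
      rw [hshift] at hk
      rw [add_tsub_cancel_left, mul_assoc,
        residueClass_mul r.2 (hf.mul_zpow_mem hp hk), hf.2 γ k hk, residueClass_coe]
    · rw [zero_mul, residueClass_zero]

/-- An initial form is represented in every class: by a scalar multiple of `f` in the class of the
weight of `f`, and by `0` in all others. -/
theorem exists_represents_valuedInitialForm (hp : Valued.v p = WithZero.exp (-1 : ℤ))
    {f : MvPolynomial (Fin n) K} {α : Fin n →₀ ℕ} (hα : IsValuedLeading w f α) (θ : ℝ) :
    ∃ c : K, Represents p w θ (MvPolynomial.C c * f) (valuedInitialForm p w f) := by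
  classical
  have hp0 := uniformizer_ne_zero hp
  by_cases hex : ∃ k : ℤ, valuedWeight w f α - k = θ
  · obtain ⟨k, hk⟩ := hex
    refine ⟨p ^ k, fun γ => ?_, fun γ j hj => ?_⟩
    · rw [MvPolynomial.coeff_C_mul]
      by_cases h0 : MvPolynomial.coeff γ f = 0
      · rw [h0, mul_zero, map_zero]
        exact zero_le
      · have h1 := hα.valuedWeight_le h0
        rw [map_mul, v_zpow hp, v_eq_exp_neg_val h0, ← WithZero.exp_add, WithZero.exp_le_exp,
          ← neg_add, neg_le_neg_iff, Int.ceil_le]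
        simp only [valuedWeight] at h1 hk
        push_cast
        linarith
    · rw [MvPolynomial.coeff_C_mul, coeff_valuedInitialForm]
      by_cases h0 : MvPolynomial.coeff γ f = 0
      · simp [h0, residueClass_zero]
      · have h1 := hα.valuedWeight_le h0
        have hγ : valuedWeight w f γ = θ + j - val (MvPolynomial.coeff γ f) := by
          rw [valuedWeight]
          linarith
        rcases h1.eq_or_lt with h2 | h2
        · have h3 : val (MvPolynomial.coeff γ f) = j - k := by
            have : (val (MvPolynomial.coeff γ f) : ℝ) = ((j - k : ℤ) : ℝ) := by
              push_cast
              linarith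
            exact_mod_cast this
          rw [if_pos ⟨h0, fun δ hδ => h2 ▸ hα.valuedWeight_le hδ⟩, h3]
          congr 1
          rw [mul_comm (p ^ k), mul_assoc, ← zpow_add₀ hp0]
          congr 2
          ring
        · have h3 : j < val (MvPolynomial.coeff γ f) + k := by
            have : (j : ℝ) < ((val (MvPolynomial.coeff γ f) + k : ℤ) : ℝ) := by
              push_cast
              linarith
            exact_mod_cast this
          have h4 : Valued.v (p ^ k * MvPolynomial.coeff γ f * p ^ (-j)) < 1 := by
            rw [map_mul, map_mul, v_zpow hp, v_zpow hp, v_eq_exp_neg_val h0, ← WithZero.exp_add,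
              ← WithZero.exp_add, ← WithZero.exp_zero, WithZero.exp_lt_exp]
            lia
          rw [if_neg fun h => (h.2 α hα.1).not_gt h2, residueClass_eq_zero_iff h4.le]
          exact h4
  · refine ⟨0, ?_⟩
    rw [map_zero, zero_mul]
    refine ⟨(Represents.zero (p := p) θ).1, fun γ j hj => ?_⟩
    rw [MvPolynomial.coeff_zero, zero_mul, residueClass_zero, coeff_valuedInitialForm, if_neg]
    rintro ⟨h0, hmax⟩
    refine hex ⟨j - val (MvPolynomial.coeff γ f), ?_⟩
    rw [le_antisymm (hmax α hα.1) (hα.valuedWeight_le h0), valuedWeight]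
    push_cast
    linarith

theorem valuedInitialForm_zero : valuedInitialForm p w (0 : MvPolynomial (Fin n) K) = 0 := by
  simp [valuedInitialForm]

theorem exists_isValuedLeading (w : Fin n → ℝ) {f : MvPolynomial (Fin n) K} (hf : f ≠ 0) :
    ∃ α, IsValuedLeading w f α := by
  obtain ⟨α, hα, hmax⟩ := Finset.exists_max_image f.support
    (fun γ => toLex (valuedWeight w f γ, toLex γ)) (MvPolynomial.support_nonempty.2 hf)
  refine ⟨α, MvPolynomial.mem_support_iff.1 hα, fun γ hγ hne => ?_⟩
  have h1 := hmax γ (MvPolynomial.mem_support_iff.2 hγ)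
  have h2 := lt_of_le_of_ne h1 fun h => hne (by simpa using congrArg Prod.snd (toLex.injective h))
  rwa [Prod.Lex.toLex_lt_toLex] at h2

theorem exists_represents (hp : Valued.v p = WithZero.exp (-1 : ℤ))
    {I : Ideal (MvPolynomial (Fin n) K)} {h : MvPolynomial (Fin n) 𝓀[K]}
    (hh : h ∈ valuedInitialIdeal p w (I : Set (MvPolynomial (Fin n) K))) (θ : ℝ) :
    ∃ f ∈ I, Represents p w θ f h := by
  induction hh using Submodule.span_induction generalizing θ with
  | mem x hx =>
    obtain ⟨f, hf, rfl⟩ := hx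
    rcases eq_or_ne f 0 with rfl | h0
    · rw [valuedInitialForm_zero]
      exact ⟨0, zero_mem _, Represents.zero θ⟩
    · obtain ⟨α, hα⟩ := exists_isValuedLeading w h0
      obtain ⟨c, hc⟩ := exists_represents_valuedInitialForm hp hα θ
      exact ⟨_, I.mul_mem_left _ hf, hc⟩
  | zero => exact ⟨0, zero_mem _, Represents.zero θ⟩
  | add x y _ _ hx hy =>
    obtain ⟨f, hf, hfx⟩ := hx θ
    obtain ⟨f', hf', hfy⟩ := hy θ
    exact ⟨f + f', add_mem hf hf', hfx.add hp hfy⟩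
  | smul q x _ hx =>
    rw [smul_eq_mul]
    induction q using MvPolynomial.induction_on' generalizing θ with
    | monomial a r =>
      obtain ⟨r, rfl⟩ := IsLocalRing.residue_surjective r
      obtain ⟨f, hf, hfx⟩ := hx (θ - ∑ i, w i * a i)
      exact ⟨_, I.mul_mem_left _ hf, hfx.monomial_mul hp r⟩
    | add q q' hq hq' =>
      obtain ⟨f, hf, hfx⟩ := hq θ
      obtain ⟨f', hf', hfy⟩ := hq' θ
      rw [add_mul]
      exact ⟨f + f', add_mem hf hf', hfx.add hp hfy⟩

/-- The lexicographical leading monomials of the ideal `in_{ν,w}(I)` are those of initial forms of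
elements of `I`. -/
theorem exists_isValuedLeading_degree (hp : Valued.v p = WithZero.exp (-1 : ℤ))
    {I : Ideal (MvPolynomial (Fin n) K)} {h : MvPolynomial (Fin n) 𝓀[K]} (h0 : h ≠ 0)
    (hh : h ∈ valuedInitialIdeal p w (I : Set (MvPolynomial (Fin n) K))) :
    ∃ f ∈ I, IsValuedLeading w f ((MonomialOrder.lex (σ := Fin n)).degree h) := by
  set α := (MonomialOrder.lex (σ := Fin n)).degree h with hαdef
  -- The class of the exponent `α` itself is the one in which the leading term of `h` is visible.
  obtain ⟨f, hf, hrep⟩ := exists_represents hp hh (∑ i, w i * α i)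
  have hα : residueClass (MvPolynomial.coeff α f) ≠ 0 := by
    have h1 := hrep.2 α 0 (by simp)
    rw [neg_zero, zpow_zero, mul_one] at h1
    rw [h1]
    exact MonomialOrder.coeff_degree_ne_zero_iff.2 h0
  have hα1 : Valued.v (MvPolynomial.coeff α f) ≤ 1 := by
    simpa using hrep.1 α
  have hα2 : Valued.v (MvPolynomial.coeff α f) = 1 :=
    le_antisymm hα1 (not_lt.1 fun h => hα ((residueClass_eq_zero_iff hα1).2 h))
  have hα3 : val (MvPolynomial.coeff α f) = 0 :=
    val_eq_of_v_eq (by rw [hα2, neg_zero, WithZero.exp_zero])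
  have hWα : valuedWeight w f α = ∑ i, w i * α i := by simp [valuedWeight, hα3]
  refine ⟨f, hf, fun h => by simp [h] at hα2, fun γ hγ hne => ?_⟩
  have h1 := hrep.1 γ
  rw [v_eq_exp_neg_val hγ, WithZero.exp_le_exp, neg_le_neg_iff, Int.ceil_le] at h1
  have hle : valuedWeight w f γ ≤ valuedWeight w f α := by
    rw [hWα, valuedWeight]
    linarith
  refine hle.lt_or_eq.imp_right fun heq => ⟨heq, ?_⟩
  have h2 := hrep.2 γ (val (MvPolynomial.coeff γ f)) (by
    rw [← hWα, ← heq, valuedWeight]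
    ring)
  have h3 : γ ∈ h.support := by
    rw [MvPolynomial.mem_support_iff, ← h2]
    exact residueClass_mul_zpow_neg_val_ne_zero hp hγ
  have h4 := (MonomialOrder.lex (σ := Fin n)).le_degree h3
  rw [MonomialOrder.lex_le_iff] at h4
  exact lt_of_le_of_ne h4 fun h => hne (toLex.injective h)

end InitialIdeal

/-! ### Initially reduced standard bases -/

section ReducedStandardBasis

variable {K : Type*} [Field K] [Valued K ℤᵐ⁰] [CompleteSpace K] {p : K}
  {hp : Valued.v p = WithZero.exp (-1 : ℤ)} {R : Subring 𝒪[K]} {n : ℕ}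
  {I : Ideal (MvPolynomial (Fin n) K)} {w : Fin n → ℝ}
  {G : Set (MvPolynomial (Fin n) (PowerSeries R))}

omit [CompleteSpace K] in
theorem v_coe_le_one (r : R) : Valued.v ((r : 𝒪[K]) : K) ≤ 1 := SetLike.coe_mem (r : 𝒪[K])

/-- A constant `r` of positive valuation is the leading term of an element `r - t * φ` of the kernel
of `π`. -/
theorem C_mem_leadingIdeal (hR : Dense (R : Set 𝒪[K])) {r : R}
    (hr : Valued.v ((r : 𝒪[K]) : K) < 1) :
    MvPolynomial.C (PowerSeries.C r) ∈ leadingIdeal ((-1 : ℝ), w)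
      (I.comap (projection R p hp) : Set (MvPolynomial (Fin n) (PowerSeries R))) := by
  classical
  rcases eq_or_ne r 0 with rfl | hr0
  · simp
  obtain ⟨d, hd⟩ := exists_eq_mul_of_v_lt_one hp hr
  obtain ⟨φ, hφ⟩ := exists_evalUniformizer_eq hp hR d
  set F : MvPolynomial (Fin n) (PowerSeries R) :=
    MvPolynomial.C (PowerSeries.C r - PowerSeries.X * φ) with hF
  have hFJ : F ∈ I.comap (projection R p hp) := by
    have h0 : projection R p hp F = 0 := by
      rw [hF, projection, MvPolynomial.map_C, map_sub, map_mul, evalUniformizer_C,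
        evalUniformizer_X, hφ, ← hd, sub_self, MvPolynomial.C_0]
    rw [Ideal.mem_comap, h0]
    exact zero_mem _
  have hF0 : coeffAt F 0 = r := by
    simp [hF, coeffAt]
  have hlead : IsLeadingMonomial ((-1 : ℝ), w) F 0 := by
    refine ⟨hF0 ▸ hr0, ?_⟩
    rintro ⟨β, α⟩ hm hne
    have hα : α = 0 := by
      by_contra h
      refine hm ?_
      rw [coeffAt, hF, MvPolynomial.coeff_C, if_neg (Ne.symm h), map_zero]
    subst hα
    have hβ : 0 < β := Nat.pos_of_ne_zero fun h => hne (by rw [h]; rfl)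
    left
    simpa [weight] using hβ
  have h1 := leadingTerm_mem_leadingIdeal (w := ((-1 : ℝ), w)) (SetLike.mem_coe.2 hFJ)
  rwa [hlead.leadingTerm_eq, termAt_zero, hF0] at h1

section

variable (hG : IsStandardBasis ((-1 : ℝ), w) (I.comap (projection R p hp)) G)
  (hGred : IsInitiallyReduced ((-1 : ℝ), w) G)

include hG in
theorem IsStandardBasis.leadingIdeal_truncation_eq :
    leadingIdeal ((-1 : ℝ), w) (truncation '' G) = leadingIdeal ((-1 : ℝ), w)
      (I.comap (projection R p hp) : Set (MvPolynomial (Fin n) (PowerSeries R))) := by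
  rw [leadingIdeal_image_truncation (by norm_num), hG.2.2]

include hGred in
omit [CompleteSpace K] in
theorem IsInitiallyReduced.exists_isLeadingMonomial {g : MvPolynomial (Fin n) (PowerSeries R)}
    (hg : g ∈ G) : ∃ m, IsLeadingMonomial ((-1 : ℝ), w) g m := by
  have hg0 : g ≠ 0 := by
    rintro rfl
    refine (hGred _ ⟨0, hg, rfl⟩).1 ?_
    rw [leadingTerm_truncation (by norm_num), leadingTerm_zero]
    exact zero_mem _
  exact (existsUnique_isLeadingMonomial (by norm_num) hg0).exists

include hG hGred in
/-- Reducedness of the truncations says that their tail terms avoid the leading ideal of `π⁻¹ I`,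
since the leading ideals of `π⁻¹ I`, of `G` and of the truncations agree. -/
theorem IsInitiallyReduced.termAt_notMem {g : MvPolynomial (Fin n) (PowerSeries R)} (hg : g ∈ G)
    {m : Mon n} (hm : IsLeadingMonomial ((-1 : ℝ), w) g m) {α : Fin n →₀ ℕ}
    (hα : MvPolynomial.coeff α g ≠ 0) (hne : lowestMon g α ≠ m) :
    termAt g (lowestMon g α) ∉ leadingIdeal ((-1 : ℝ), w)
      (I.comap (projection R p hp) : Set (MvPolynomial (Fin n) (PowerSeries R))) := by
  have hc : coeffAt (truncation g) (lowestMon g α) = coeffAt g (lowestMon g α) := by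
    rw [coeffAt_truncation]
    exact if_pos rfl
  have h1 := (hGred _ ⟨g, hg, rfl⟩).2 (lowestMon g α) (hc ▸ coeffAt_lowestMon_ne_zero hα)
    fun h => hne (h.unique (hm.truncation (by norm_num)))
  rw [hG.leadingIdeal_truncation_eq] at h1
  rwa [termAt, hc] at h1

include hG hGred in
/-- The lowest coefficients in the tail of an element of `G` are units: constants of positive
valuation lie in the leading ideal. -/
theorem IsInitiallyReduced.v_tail_eq_one (hR : Dense (R : Set 𝒪[K]))
    {g : MvPolynomial (Fin n) (PowerSeries R)} (hg : g ∈ G)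
    {m : Mon n} (hm : IsLeadingMonomial ((-1 : ℝ), w) g m) {α : Fin n →₀ ℕ}
    (hα : MvPolynomial.coeff α g ≠ 0) (hne : lowestMon g α ≠ m) :
    Valued.v (((coeffAt g (lowestMon g α) : R) : 𝒪[K]) : K) = 1 := by
  refine le_antisymm (v_coe_le_one _) (not_lt.1 fun hlt => ?_)
  exact hGred.termAt_notMem hG hg hm hα hne (termAt_mem_of_C_mem (C_mem_leadingIdeal hR hlt))

include hG hGred in
theorem IsInitiallyReduced.hasUnitLowest (hR : Dense (R : Set 𝒪[K]))
    {g : MvPolynomial (Fin n) (PowerSeries R)} (hg : g ∈ G)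
    {m : Mon n} (hm : IsLeadingMonomial ((-1 : ℝ), w) g m)
    (hv : Valued.v (((coeffAt g m : R) : 𝒪[K]) : K) = 1) : HasUnitLowest g := by
  intro α hα
  by_cases hne : lowestMon g α = m
  · rw [hne, hv]
  · exact hGred.v_tail_eq_one hG hR hg hm hα hne

include hG hGred in
/-- By minimality, an element of `G` whose leading coefficient is not a unit has leading
monomial `1`. -/
theorem IsInitiallyReduced.leadingMonomial_eq_zero (hR : Dense (R : Set 𝒪[K]))
    {g : MvPolynomial (Fin n) (PowerSeries R)} (hg : g ∈ G)
    {m : Mon n} (hm : IsLeadingMonomial ((-1 : ℝ), w) g m)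
    (hv : Valued.v (((coeffAt g m : R) : 𝒪[K]) : K) < 1) : m = 0 := by
  by_contra hm0
  have hm' := hm.truncation (by norm_num)
  have hc : coeffAt (truncation g) m = coeffAt g m := by
    rw [coeffAt_truncation, if_pos (hm.eq_lowestMon (by norm_num))]
  refine (hGred _ ⟨g, hg, rfl⟩).1 ?_
  rw [hm'.leadingTerm_eq]
  refine termAt_mem_of_C_mem (C_mem_leadingIdeal_of_subset (S := truncation '' G) ?_ ?_)
  · rw [hG.leadingIdeal_truncation_eq, hc]
    exact C_mem_leadingIdeal hR hv
  · exact fun h hh hlead => ⟨hh, fun heq => hm0 (hm'.unique (heq ▸ hlead))⟩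

end

omit [CompleteSpace K] in
/-- If the leading monomial is `1`, then the initial form is constant: every other monomial of
weight `0` is either a power of `t` or lexicographically larger than `1`. -/
theorem residueAtOne_initialForm_eq_zero {g : MvPolynomial (Fin n) (PowerSeries R)}
    (hm : IsLeadingMonomial ((-1 : ℝ), w) g 0)
    (hv : Valued.v (((coeffAt g 0 : R) : 𝒪[K]) : K) < 1) :
    residueAtOne R (initialForm ((-1 : ℝ), w) g) = 0 := by
  have hset : initialSupport ((-1 : ℝ), w) g = {0} := by
    ext m
    rw [Set.mem_singleton_iff]
    constructor
    · rintro ⟨h1, h2⟩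
      by_contra hne
      rcases hm.2 m h1 hne with h3 | ⟨h3, h4 | ⟨h4, h5⟩⟩
      · exact h3.not_ge (h2 0 hm.1)
      · exact h4.not_ge (Finsupp.toLex_monotone zero_le)
      · have h6 : weight ((-1 : ℝ), w) m = -m.1 := by simp [weight, h4]
        have h7 : weight ((-1 : ℝ), w) (0 : Mon n) = 0 := by simp [weight]
        have h8 : (0 : ℝ) < m.1 := by exact_mod_cast h5
        linarith
    · rintro rfl
      refine ⟨hm.1, fun m' hm' => ?_⟩
      by_cases hne : m' = 0
      · rw [hne]
      · rcases hm.2 m' hm' hne with h | h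
        · exact h.le
        · exact h.1.le
  rw [initialForm, hset, finsum_mem_singleton, residueAtOne, MvPolynomial.map_monomial]
  have h0 := (residue_eq_zero_iff_v_lt_one ((coeffAt g 0 : R) : 𝒪[K])).2 hv
  simp [h0]

section

variable (hG : IsStandardBasis ((-1 : ℝ), w) (I.comap (projection R p hp)) G)
  (hGred : IsInitiallyReduced ((-1 : ℝ), w) G)

include hG hGred in
theorem IsInitiallyReduced.hasUnitLowest_or (hR : Dense (R : Set 𝒪[K]))
    {g : MvPolynomial (Fin n) (PowerSeries R)} (hg : g ∈ G) :
    HasUnitLowest g ∨ residueAtOne R (initialForm ((-1 : ℝ), w) g) = 0 := by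
  obtain ⟨m, hm⟩ := hGred.exists_isLeadingMonomial hg
  rcases (v_coe_le_one (coeffAt g m)).eq_or_lt with hv | hv
  · exact Or.inl (hGred.hasUnitLowest hG hR hg hm hv)
  · obtain rfl := hGred.leadingMonomial_eq_zero hG hR hg hm hv
    exact Or.inr (residueAtOne_initialForm_eq_zero hm hv)

include hG hGred in
/-- The leading exponent of every initial form of `I` is a multiple of the leading exponent of some
`g ∈ G` with unit lowest coefficients. -/
theorem IsInitiallyReduced.exists_le_of_isValuedLeading (hR : Dense (R : Set 𝒪[K]))
    {f : MvPolynomial (Fin n) K} (hf : f ∈ I) {α : Fin n →₀ ℕ} (hα : IsValuedLeading w f α) :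
    ∃ g ∈ G, HasUnitLowest g ∧ ∃ m, IsLeadingMonomial ((-1 : ℝ), w) g m ∧ m.2 ≤ α := by
  have hf0 : f ≠ 0 := by
    rintro rfl
    exact hα.1 (by simp)
  obtain ⟨c, F, m, -, hF, hFu, hm, hmα⟩ := exists_lift_isLeadingMonomial hp hR w hf0
  obtain rfl := hmα.unique hα
  have hFJ : F ∈ I.comap (projection R p hp) := by
    rw [Ideal.mem_comap, hF]
    exact I.mul_mem_left _ hf
  have h1 := leadingTerm_mem_leadingIdeal (w := ((-1 : ℝ), w)) (SetLike.mem_coe.2 hFJ)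
  rw [hm.leadingTerm_eq, ← hG.2.2] at h1
  have h2 := coeffAt_mem_span_of_mem_leadingIdeal h1 m
  rw [coeffAt_termAt, if_pos rfl] at h2
  by_contra hcon
  have h3 : Ideal.span (leadingCoeffsDividing ((-1 : ℝ), w) G m) ≤
      RingHom.ker ((IsLocalRing.residue 𝒪[K]).comp R.subtype) := by
    refine Ideal.span_le.2 ?_
    rintro _ ⟨g, hg, m', hm', hle, rfl⟩
    refine (residue_eq_zero_iff_v_lt_one _).2 (lt_of_le_of_ne (v_coe_le_one _) fun hv => hcon ?_)
    exact ⟨g, hg, hGred.hasUnitLowest hG hR hg hm' hv, m', hm', hle.2⟩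
  have h4 := (residue_eq_zero_iff_v_lt_one _).1 (h3 h2)
  have h5 := hFu m.2 (coeff_ne_zero_of_coeffAt_ne_zero hm.1)
  rw [← hm.eq_lowestMon (by norm_num)] at h5
  exact h4.ne h5

theorem map_homogeneousComponent {A B : Type*} [CommSemiring A] [CommSemiring B] (φ : A →+* B)
    (d : ℕ) (f : MvPolynomial (Fin n) A) :
    MvPolynomial.map φ (MvPolynomial.homogeneousComponent d f) =
      MvPolynomial.homogeneousComponent d (MvPolynomial.map φ f) := by
  classical
  ext α
  simp only [MvPolynomial.coeff_map, MvPolynomial.coeff_homogeneousComponent]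
  split_ifs
  · rfl
  · exact map_zero φ

include hG hGred in
/-- The elements of `G` are homogeneous in `x`: their homogeneous components lie in `π⁻¹ I`, so by
reducedness only the component containing the leading term can be nonzero. -/
theorem IsInitiallyReduced.isHomogeneous (hI : IsHomogeneousIdeal I)
    {g : MvPolynomial (Fin n) (PowerSeries R)} (hg : g ∈ G)
    {m : Mon n} (hm : IsLeadingMonomial ((-1 : ℝ), w) g m) : g.IsHomogeneous m.2.degree := by
  classical
  suffices h : ∀ γ, MvPolynomial.coeff γ g ≠ 0 → γ.degree = m.2.degree by
    have hself : MvPolynomial.homogeneousComponent m.2.degree g = g := by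
      ext1 γ
      rw [MvPolynomial.coeff_homogeneousComponent]
      split_ifs with hγ
      · rfl
      · by_contra hne
        exact hγ (h γ (Ne.symm hne))
    rw [← hself]
    exact MvPolynomial.homogeneousComponent_isHomogeneous _ _
  intro γ hγ
  by_contra hdeg
  set q := MvPolynomial.homogeneousComponent γ.degree g with hq
  have hqJ : q ∈ I.comap (projection R p hp) := by
    rw [Ideal.mem_comap, projection, hq, map_homogeneousComponent]
    exact MvPolynomial.homogeneousComponent_mem_of_mem hI (hG.2.1 hg) _
  have hcoeff : ∀ δ : Fin n →₀ ℕ, MvPolynomial.coeff δ q ≠ 0 →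
      δ.degree = γ.degree ∧ MvPolynomial.coeff δ q = MvPolynomial.coeff δ g := by
    intro δ hδ
    rw [hq, MvPolynomial.coeff_homogeneousComponent] at hδ ⊢
    obtain ⟨h1, -⟩ := ite_ne_right_iff.1 hδ
    exact ⟨h1, if_pos h1⟩
  have hq0 : q ≠ 0 := by
    intro h0
    have h1 : MvPolynomial.coeff γ q = MvPolynomial.coeff γ g := by
      rw [hq, MvPolynomial.coeff_homogeneousComponent, if_pos rfl]
    exact hγ (by rw [← h1, h0, MvPolynomial.coeff_zero])
  obtain ⟨m₁, hm₁, -⟩ :=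
    existsUnique_isLeadingMonomial (w := ((-1 : ℝ), w)) (by norm_num) hq0
  obtain ⟨hd, hc⟩ := hcoeff m₁.2 (coeff_ne_zero_of_coeffAt_ne_zero hm₁.1)
  have hlow : m₁ = lowestMon g m₁.2 := by
    have := hm₁.eq_lowestMon (by norm_num)
    rwa [lowestMon, hc] at this
  have hterm : termAt q m₁ = termAt g m₁ := by rw [termAt, termAt, coeffAt, coeffAt, hc]
  have h1 := leadingTerm_mem_leadingIdeal (w := ((-1 : ℝ), w)) (SetLike.mem_coe.2 hqJ)
  rw [hm₁.leadingTerm_eq, hterm, hlow] at h1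
  refine hGred.termAt_notMem hG hg hm (α := m₁.2) ?_ ?_ h1
  · rw [← hc]
    exact coeff_ne_zero_of_coeffAt_ne_zero hm₁.1
  · rw [← hlow]
    rintro rfl
    exact hdeg hd.symm

end

end ReducedStandardBasis

/-! ### Generation of homogeneous ideals -/

section Generation

variable {K : Type*} [Field K] [Valued K ℤᵐ⁰] {n : ℕ} {w : Fin n → ℝ}

theorem IsValuedLeading.monomial_mul {f : MvPolynomial (Fin n) K} {α : Fin n →₀ ℕ}
    (h : IsValuedLeading w f α) (a : Fin n →₀ ℕ) :
    IsValuedLeading w (MvPolynomial.monomial a 1 * f) (a + α) := by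
  have hV : ∀ γ, valuedWeight w (MvPolynomial.monomial a 1 * f) (a + γ) =
      ∑ i, w i * a i + valuedWeight w f γ := by
    intro γ
    rw [valuedWeight, valuedWeight, sum_mul_add, MvPolynomial.coeff_monomial_mul, one_mul]
    ring
  refine ⟨by rw [MvPolynomial.coeff_monomial_mul, one_mul]; exact h.1, fun γ hγ hne => ?_⟩
  rw [MvPolynomial.coeff_monomial_mul'] at hγ
  obtain ⟨hle, hγ⟩ := ite_ne_right_iff.1 hγ
  obtain ⟨δ, rfl⟩ := exists_add_of_le hle
  rw [add_tsub_cancel_left, one_mul] at hγ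
  rw [hV, hV]
  rcases h.2 δ hγ (fun h => hne (by rw [h])) with h1 | ⟨h1, h2⟩
  · left
    linarith
  · right
    refine ⟨by rw [h1], ?_⟩
    rw [toLex_add, toLex_add]
    exact add_lt_add_right h2 _

/-- In a nontrivial linear combination of polynomials `h α` with pairwise distinct leading
exponents `α`, the coefficient at the leading exponent of the dominating summand does not cancel. -/
theorem exists_coeff_sum_ne_zero {N : Finset (Fin n →₀ ℕ)}
    {h : (Fin n →₀ ℕ) → MvPolynomial (Fin n) K} (hh : ∀ α ∈ N, IsValuedLeading w (h α) α)
    {c : N → K} (hc : c ≠ 0) :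
    ∃ β : N, MvPolynomial.coeff (β : Fin n →₀ ℕ) (∑ α : N, c α • h α) ≠ 0 := by
  classical
  obtain ⟨β₀, hβ₀⟩ := Function.ne_iff.1 hc
  obtain ⟨β, hβ, hmax⟩ := Finset.exists_max_image (Finset.univ.filter fun α : N => c α ≠ 0)
    (fun α => toLex (valuedWeight w (c α • h α) α, toLex (α : Fin n →₀ ℕ)))
    ⟨β₀, by simpa using hβ₀⟩
  have hβ0 : c β ≠ 0 := by simpa using hβ
  have hlead : ∀ α : N, c α ≠ 0 → IsValuedLeading w (c α • h α) α := by
    intro α hα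
    rw [MvPolynomial.smul_eq_C_mul, isValuedLeading_C_mul_iff hα]
    exact hh α α.2
  have hown := (hlead β hβ0).1
  refine ⟨β, ?_⟩
  rw [MvPolynomial.coeff_sum, ← Finset.add_sum_erase _ _ (Finset.mem_univ β)]
  have hother : ∀ α ∈ Finset.univ.erase β,
      Valued.v (MvPolynomial.coeff (β : Fin n →₀ ℕ) (c α • h α)) <
        Valued.v (MvPolynomial.coeff (β : Fin n →₀ ℕ) (c β • h β)) := by
    intro α hα
    have hne := Finset.ne_of_mem_erase hα
    by_cases h0 : MvPolynomial.coeff (β : Fin n →₀ ℕ) (c α • h α) = 0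
    · rw [h0, map_zero, zero_lt_iff]
      simpa using hown
    have hα0 : c α ≠ 0 := by
      intro h1
      simp [h1] at h0
    have h1 := (hlead α hα0).2 β h0 fun h => hne (Subtype.ext h.symm)
    have h2 := hmax α (by simpa using hα0)
    rw [Prod.Lex.toLex_le_toLex] at h2
    have h3 : valuedWeight w (c α • h α) β < valuedWeight w (c β • h β) β := by
      rcases h1 with h1 | ⟨h1, h1'⟩ <;> rcases h2 with h2 | ⟨h2, h2'⟩
      · exact h1.trans h2
      · exact h1.trans_eq h2
      · exact h1.trans_lt h2
      · exact absurd h2' h1'.not_ge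
    simp only [valuedWeight] at h3
    rw [v_eq_exp_neg_val h0, v_eq_exp_neg_val hown, WithZero.exp_lt_exp, neg_lt_neg_iff]
    have h4 : (val (MvPolynomial.coeff (β : Fin n →₀ ℕ) (c β • h β)) : ℝ) <
        val (MvPolynomial.coeff (β : Fin n →₀ ℕ) (c α • h α)) := by linarith
    exact_mod_cast h4
  have hv0 : Valued.v (MvPolynomial.coeff (β : Fin n →₀ ℕ) (c β • h β)) ≠ 0 := by
    simpa using hown
  have hsum := Valuation.map_sum_lt (Valued.v (R := K)) hv0 hother
  intro hzero
  have h5 := Valuation.map_add_eq_of_lt_left (Valued.v (R := K)) hsum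
  rw [hzero, map_zero] at h5
  exact hv0 h5.symm

/-- Polynomials with prescribed distinct leading exponents in `N` allow to clear all coefficients at
`N` simultaneously: the square linear system is injective, hence solvable. -/
theorem exists_coeff_sub_sum_eq_zero {N : Finset (Fin n →₀ ℕ)}
    {h : (Fin n →₀ ℕ) → MvPolynomial (Fin n) K} (hh : ∀ α ∈ N, IsValuedLeading w (h α) α)
    (f : MvPolynomial (Fin n) K) :
    ∃ c : N → K, ∀ β ∈ N, MvPolynomial.coeff β (f - ∑ α : N, c α • h α) = 0 := by
  let T : (N → K) →ₗ[K] (N → K) :=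
    (LinearMap.pi fun β : N => MvPolynomial.lcoeff K (β : Fin n →₀ ℕ)) ∘ₗ
      Fintype.linearCombination K fun α : N => h α
  have hT : ∀ c β, T c β = MvPolynomial.coeff (β : Fin n →₀ ℕ) (∑ α : N, c α • h α) := by
    intro c β
    simp [T, Fintype.linearCombination_apply, MvPolynomial.coeff_sum]
  have hinj : Function.Injective T := by
    rw [← LinearMap.ker_eq_bot, LinearMap.ker_eq_bot']
    intro c hc
    by_contra hc0
    obtain ⟨β, hβ⟩ := exists_coeff_sum_ne_zero hh hc0
    exact hβ (by rw [← hT, hc]; rfl)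
  obtain ⟨c, hc⟩ := LinearMap.injective_iff_surjective.1 hinj
    fun β => MvPolynomial.coeff (β : Fin n →₀ ℕ) f
  refine ⟨c, fun β hβ => ?_⟩
  rw [MvPolynomial.coeff_sub, ← hT c ⟨β, hβ⟩, hc, sub_self]

/-- Homogeneous elements of a homogeneous ideal `I` generate it as soon as their leading exponents
divide all leading exponents of `I`. Homogeneity confines the argument to finitely many
monomials. -/
theorem span_eq_of_forall_exists_le {I : Ideal (MvPolynomial (Fin n) K)}
    (hI : IsHomogeneousIdeal I) {B : Set (MvPolynomial (Fin n) K)} (hB : B ⊆ I)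
    (hlead : ∀ f ∈ I, ∀ α, IsValuedLeading w f α →
      ∃ b ∈ B, ∃ γ, IsValuedLeading w b γ ∧ b.IsHomogeneous γ.degree ∧ γ ≤ α) :
    Ideal.span B = I := by
  classical
  refine le_antisymm (Ideal.span_le.2 hB) fun f hf => ?_
  rw [← MvPolynomial.sum_homogeneousComponent f]
  refine sum_mem fun d _ => ?_
  have hfd : MvPolynomial.homogeneousComponent d f ∈ I :=
    MvPolynomial.homogeneousComponent_mem_of_mem hI hf d
  have hhom := MvPolynomial.homogeneousComponent_isHomogeneous d f
  generalize MvPolynomial.homogeneousComponent d f = q at hfd hhom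
  let E : Set (Fin n →₀ ℕ) := {α | α.degree = d ∧
    ∃ b ∈ B, ∃ γ, IsValuedLeading w b γ ∧ b.IsHomogeneous γ.degree ∧ γ ≤ α}
  have hE : E.Finite := (Finsupp.finite_of_degree_eq d).subset fun α hα => hα.1
  have hex : ∀ α, ∃ q : MvPolynomial (Fin n) K, α ∈ E →
      q ∈ Ideal.span B ∧ IsValuedLeading w q α ∧ q.IsHomogeneous d := by
    intro α
    by_cases hα : α ∈ E
    · obtain ⟨hd, b, hb, γ, hγ, hbhom, hle⟩ := hα
      obtain ⟨a, rfl⟩ := exists_add_of_le hle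
      refine ⟨MvPolynomial.monomial a 1 * b, fun _ =>
        ⟨Ideal.mul_mem_left _ _ (Ideal.subset_span hb), ?_, ?_⟩⟩
      · rw [add_comm γ a]
        exact hγ.monomial_mul a
      · rw [← hd, map_add, add_comm]
        exact (MvPolynomial.isHomogeneous_monomial 1 rfl).mul hbhom
    · exact ⟨0, fun h => absurd h hα⟩
  choose h hh using hex
  have hmem : ∀ α : hE.toFinset, (α : Fin n →₀ ℕ) ∈ E := fun α => hE.mem_toFinset.1 α.2
  obtain ⟨c, hc⟩ := exists_coeff_sub_sum_eq_zero (N := hE.toFinset) (w := w)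
    (fun α hα => (hh α (hE.mem_toFinset.1 hα)).2.1) q
  have hsum : ∑ α : hE.toFinset, c α • h α ∈ Ideal.span B := by
    refine sum_mem fun α _ => ?_
    rw [MvPolynomial.smul_eq_C_mul]
    exact Ideal.mul_mem_left _ _ (hh α (hmem α)).1
  have hsumhom : (∑ α : hE.toFinset, c α • h α).IsHomogeneous d := by
    refine MvPolynomial.IsHomogeneous.sum _ _ _ fun α _ => ?_
    rw [MvPolynomial.smul_eq_C_mul]
    exact (hh α (hmem α)).2.2.C_mul _
  suffices hzero : q - ∑ α : hE.toFinset, c α • h α = 0 by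
    rw [sub_eq_zero.1 hzero]
    exact hsum
  by_contra hne
  obtain ⟨α, hα⟩ := exists_isValuedLeading w hne
  have hdI : q - ∑ α : hE.toFinset, c α • h α ∈ I :=
    sub_mem hfd (Ideal.span_le.2 hB hsum)
  have hαd : α.degree = d := by
    by_contra hd
    exact hα.1 ((hhom.sub hsumhom).coeff_eq_zero hd)
  exact hα.1 (hc α (hE.mem_toFinset.2 ⟨hαd, hlead _ hdI α hα⟩))

end Generation

end ValuedStandardBases

end

open ValuedStandardBases in
theorem mainTheorem7 {K : Type*} [Field K] [Valued K ℤᵐ⁰] [CompleteSpace K]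
    (p : K) (hp : Valued.v p = WithZero.exp (-1 : ℤ))
    (R : Subring 𝒪[K]) [IsNoetherianRing R] (hR : Dense (R : Set 𝒪[K]))
    {n : ℕ} (I : Ideal (MvPolynomial (Fin n) K)) (hI : ValuedStandardBases.IsHomogeneousIdeal I)
    (w : Fin n → ℝ) (G : Set (MvPolynomial (Fin n) (PowerSeries R)))
    (hG : ValuedStandardBases.IsStandardBasis ((-1 : ℝ), w)
      (I.comap (ValuedStandardBases.projection R p hp)) G)
    (hGred : ValuedStandardBases.IsInitiallyReduced ((-1 : ℝ), w) G) :
    ValuedStandardBases.IsLexStandardBasis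
        (ValuedStandardBases.valuedInitialIdeal p w (I : Set (MvPolynomial (Fin n) K)))
        ((fun g => ValuedStandardBases.residueAtOne R
          (ValuedStandardBases.initialForm ((-1 : ℝ), w) g)) '' G) ∧
      ValuedStandardBases.IsValuedGroebnerBasis p w I
        (ValuedStandardBases.projection R p hp '' G) := by
  have hGI : ∀ g ∈ G, projection R p hp g ∈ I := fun g hg => hG.2.1 hg
  have hinI : ∀ g ∈ G, valuedInitialForm p w (projection R p hp g) ∈
      valuedInitialIdeal p w (I : Set (MvPolynomial (Fin n) K)) := fun g hg =>
    Ideal.subset_span ⟨_, hGI g hg, rfl⟩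
  -- Every lexicographical leading exponent of `in_{ν,w}(I)` is a multiple of one coming from `G`.
  have key : ∀ h ∈ valuedInitialIdeal p w (I : Set (MvPolynomial (Fin n) K)), h ≠ 0 →
      ∃ g ∈ G, HasUnitLowest g ∧ valuedInitialForm p w (projection R p hp g) ≠ 0 ∧
        (MonomialOrder.lex (σ := Fin n)).degree (valuedInitialForm p w (projection R p hp g)) ≤
          (MonomialOrder.lex (σ := Fin n)).degree h := by
    intro h hh h0
    obtain ⟨f, hf, hlead⟩ := exists_isValuedLeading_degree hp h0 hh
    obtain ⟨g, hg, hgu, m, hm, hle⟩ := hGred.exists_le_of_isValuedLeading hG hR hf hlead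
    have hV := hgu.isValuedLeading (hp := hp) hm
    refine ⟨g, hg, hgu, fun hz => ?_, ?_⟩
    · exact hV.coeff_valuedInitialForm_ne_zero hp (by rw [hz, MvPolynomial.coeff_zero])
    · rwa [hV.degree_valuedInitialForm hp]
  have hsub : (fun g => residueAtOne R (initialForm ((-1 : ℝ), w) g)) '' G ⊆
      (valuedInitialIdeal p w (I : Set (MvPolynomial (Fin n) K)) :
        Set (MvPolynomial (Fin n) 𝓀[K])) := by
    rintro _ ⟨g, hg, rfl⟩
    rcases hGred.hasUnitLowest_or hG hR hg with hu | hz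
    · rw [SetLike.mem_coe]
      beta_reduce
      rw [hu.residueAtOne_initialForm (hp := hp)]
      exact hinI g hg
    · rw [SetLike.mem_coe]
      beta_reduce
      rw [hz]
      exact zero_mem _
  refine ⟨⟨hG.1.image _, hsub, le_antisymm (Ideal.span_mono (Set.image_mono hsub)) ?_⟩,
    hG.1.image _, ?_, le_antisymm (Ideal.span_mono (Set.image_mono ?_)) ?_⟩
  · refine Ideal.span_le.2 ?_
    rintro _ ⟨h, hh, rfl⟩
    rcases eq_or_ne h 0 with rfl | h0
    · rw [MonomialOrder.leadingTerm_zero]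
      exact zero_mem _
    obtain ⟨g, hg, hgu, hne, hle⟩ := key h hh h0
    have h1 : (MonomialOrder.lex (σ := Fin n)).leadingTerm
        (valuedInitialForm p w (projection R p hp g)) ∈
        Ideal.span ((MonomialOrder.lex (σ := Fin n)).leadingTerm ''
          ((fun g => residueAtOne R (initialForm ((-1 : ℝ), w) g)) '' G)) :=
      Ideal.subset_span ⟨_, ⟨g, hg, hgu.residueAtOne_initialForm⟩, rfl⟩
    set b := valuedInitialForm p w (projection R p hp g)
    obtain ⟨a, ha⟩ := exists_add_of_le hle
    have hb : (MonomialOrder.lex (σ := Fin n)).leadingCoeff b ≠ 0 :=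
      MonomialOrder.leadingCoeff_ne_zero_iff.2 hne
    have h2 : (MonomialOrder.lex (σ := Fin n)).leadingTerm h =
        MvPolynomial.monomial a ((MonomialOrder.lex (σ := Fin n)).leadingCoeff h *
          ((MonomialOrder.lex (σ := Fin n)).leadingCoeff b)⁻¹) *
        (MonomialOrder.lex (σ := Fin n)).leadingTerm b := by
      rw [MonomialOrder.leadingTerm, MonomialOrder.leadingTerm, MvPolynomial.monomial_mul,
        inv_mul_cancel_right₀ hb, ha, add_comm]
    rw [SetLike.mem_coe, h2]
    exact Ideal.mul_mem_left _ _ h1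
  · refine span_eq_of_forall_exists_le (w := w) hI ?_ fun f hf α hα => ?_
    · rintro _ ⟨g, hg, rfl⟩
      exact hGI g hg
    · obtain ⟨g, hg, hgu, m, hm, hle⟩ := hGred.exists_le_of_isValuedLeading hG hR hf hα
      exact ⟨_, ⟨g, hg, rfl⟩, m.2, hgu.isValuedLeading hm,
        (hGred.isHomogeneous hG hI hg hm).map _, hle⟩
  · rintro _ ⟨g, hg, rfl⟩
    exact hGI g hg
  · intro h hh
    -- Division by the nonzero initial forms leaves a remainder in `in_{ν,w}(I)`, hence zero.
    obtain ⟨q, r, heq, -, hr⟩ := (MonomialOrder.lex (σ := Fin n)).div_set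
      (B := (fun g => valuedInitialForm p w (projection R p hp g)) '' G \ {0})
      (fun b hb => (MonomialOrder.leadingCoeff_ne_zero_iff.2 hb.2).isUnit) h
    have hq : Finsupp.linearCombination (MvPolynomial (Fin n) 𝓀[K])
        (fun b : ((fun g => valuedInitialForm p w (projection R p hp g)) '' G \ {0} :
          Set (MvPolynomial (Fin n) 𝓀[K])) => (b : MvPolynomial (Fin n) 𝓀[K])) q ∈
        valuedInitialIdeal p w (projection R p hp '' G) := by
      rw [Finsupp.linearCombination_apply]
      refine sum_mem fun b _ => Ideal.mul_mem_left _ _ ?_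
      obtain ⟨b, ⟨g, hg, rfl⟩, -⟩ := b
      exact Ideal.subset_span ⟨_, ⟨g, hg, rfl⟩, rfl⟩
    suffices hr0 : r = 0 by
      rw [heq, hr0, add_zero]
      exact hq
    by_contra hr0
    have hrI : r ∈ valuedInitialIdeal p w (I : Set (MvPolynomial (Fin n) K)) := by
      rw [eq_sub_of_add_eq' heq.symm]
      refine sub_mem hh (Ideal.span_mono (Set.image_mono ?_) hq)
      rintro _ ⟨g, hg, rfl⟩
      exact hGI g hg
    obtain ⟨g, hg, -, hne, hle⟩ := key r hrI hr0
    exact hr _ (MonomialOrder.degree_mem_support hr0) _ ⟨⟨g, hg, rfl⟩, hne⟩ hle
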